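/- Let $(X,\mathrm{dist})$ be a geodesic metric space. For a non-principal ultrafilter $\omega$ on $\mathbb N$, a sequence $e=(e_n)$ in $X$ and a sequence $d=(d_n)$ in $(0,\infty)$ with $\lim_\omega d_n=\infty$, let $\mathrm{Con}_\omega(X;e,d)$ be the asymptotic cone: the sequences $(x_n)$ in $X$ with $\mathrm{dist}(x_n,e_n)\le M d_n$ $\omega$-almost surely for some $M$, modulo $\lim_\omega \mathrm{dist}(x_n,y_n)/d_n=0$, with metric $\lim_\omega \mathrm{dist}(x_n,y_n)/d_n$. The limit set $\lim_\omega A_n$ of a sequence of subsets $A_n\subseteq X$ is the set of points represented by such sequences $(a_n)$ with $a_n\in A_n$ $\omega$-almost surely. A geodesic segment of the cone is a limit geodesic if it is the limit set of a sequence of geodesic segments of $X$. A geodesic triangle is simple if any two of its edges meet only in their common vertex, and non-trivial if it is not a single point. For a collection $\mathcal P$ of subsets of the cone consider: * $(T_1)$ any two different members of $\mathcal P$ have at most one point in common; * $(T_2)$ every simple non-trivial geodesic triangle is contained in one member of $\mathcal P$; * $(\Pi_3)$ every simple non-trivial triangle whose edges are limit geodesics is contained in one member of $\mathcal P$. (i)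 In any asymptotic cone of $X$, if a collection $\mathcal P$ of closed subsets satisfies $(T_1)$ and $(\Pi_3)$, then it satisfies $(T_2)$. (ii) Let $\mathcal A=\{A_i : i\in I\}$ be a collection of subsets of $X$, and in each asymptotic cone let $\mathcal A_\omega$ be the collection of all limit sets $\lim_\omega A_{i_n}$ of sequences $(i_n)$ in $I$ for which there is $M$ with $\mathrm{dist}(e_n,A_{i_n})\le M d_n$ $\omega$-almost surely (the distance to the empty set being $+\infty$). Assume * $(\beta_3)$ there exist $\theta>0$, $\nu\ge 8$ and $\chi>0$ such that every $(\theta,\nu)$-fat geodesic hexagon in $X$ is contained in $\{x : \mathrm{dist}(x,A)<\chi\}$ for some $A\in\mathcal A$, and assume that $\mathcal A_\omega$ satisfies $(T_1)$ in every asymptotic cone of $X$. Then $\mathcal A_\omega$ satisfies $(T_2)$ in every asymptotic cone of $X$. Here a geodesic polygon is $(\theta,\nu)$-fat if (F1) for every edge $\mathfrak q$, each point of $\mathfrak q$ at distance at least $2\theta$ from both endpoints of $\mathfrak q$ is at distance at least $\theta$ from each of the other edges, and (F2) every vertex is at distance at least $\nu\theta$ from each edge other than the two adjacent to it. -/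

import Mathlib

open Filter Topology Set

/-- `s` is (the image of) a geodesic from `x` to `y`: an isometric copy of `[0, dist x y]`. -/
def IsGeodesicSegment {Y : Type*} [MetricSpace Y] (x y : Y) (s : Set Y) : Prop :=
  ∃ γ : ℝ → Y, γ 0 = x ∧ γ (dist x y) = y ∧
    (∀ t ∈ Icc 0 (dist x y), ∀ t' ∈ Icc 0 (dist x y), dist (γ t) (γ t') = |t - t'|) ∧
    γ '' Icc 0 (dist x y) = s

/-- Every two points are joined by a geodesic. -/
def IsGeodesicSpace (Y : Type*) [MetricSpace Y] : Prop :=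
  ∀ x y : Y, ∃ s : Set Y, IsGeodesicSegment x y s

/-- A geodesic `k`-gon with vertices `v 0, …, v (k-1)` in cyclic order; the `i`-th edge `q i` is a
geodesic from `v i` to `v (i + 1)`, indices modulo `k`. -/
def IsGeodesicPolygon {Y : Type*} [MetricSpace Y] {k : ℕ} [NeZero k]
    (v : Fin k → Y) (q : Fin k → Set Y) : Prop :=
  ∀ i, IsGeodesicSegment (v i) (v (i + 1)) (q i)

/-- A simple non-trivial geodesic triangle: two edges meet only in their common vertex, and the
triangle is not reduced to a point. -/
def IsSimpleTriangle {Y : Type*} [MetricSpace Y] (v : Fin 3 → Y) (q : Fin 3 → Set Y) : Prop :=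
  IsGeodesicPolygon v q ∧ (∀ i, q i ∩ q (i + 1) = {v (i + 1)}) ∧ (⋃ i, q i).Nontrivial

/-- A `(θ, ν)`-fat geodesic polygon. The first clause: points of an edge `q i` at distance at
least `2 θ` from both endpoints of `q i` are at distance at least `θ` from all other edges.
The second clause: every vertex `v (i + 1)` is at distance at least `ν θ` from all edges other
than the two edges `q i`, `q (i + 1)` adjacent to it. -/
def IsFatPolygon {Y : Type*} [MetricSpace Y] {k : ℕ} [NeZero k] (θ ν : ℝ)
    (v : Fin k → Y) (q : Fin k → Set Y) : Prop :=
  (∀ i j, j ≠ i → ∀ p ∈ q i, 2 * θ ≤ dist p (v i) → 2 * θ ≤ dist p (v (i + 1)) →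
    ∀ r ∈ q j, θ ≤ dist p r) ∧
  (∀ i j, j ≠ i → j ≠ i + 1 → ∀ r ∈ q j, ν * θ ≤ dist (v (i + 1)) r)

/-- Property `(β₃)`: for some constants, every fat geodesic hexagon is contained in the open
`χ`-neighbourhood of some `A i`. -/
def PropBeta3 {X ι : Type*} [MetricSpace X] (A : ι → Set X) : Prop :=
  ∃ θ ν χ : ℝ, 0 < θ ∧ 8 ≤ ν ∧ 0 < χ ∧
    ∀ (v : Fin 6 → X) (q : Fin 6 → Set X), IsGeodesicPolygon v q → IsFatPolygon θ ν v q →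
      ∃ i : ι, (⋃ j, q j) ⊆ Metric.thickening χ (A i)

/-- Property `(T₁)`: two different pieces have at most one point in common. -/
def PropT1 {Y : Type*} (P : Set (Set Y)) : Prop :=
  ∀ B ∈ P, ∀ B' ∈ P, B ≠ B' → (B ∩ B').Subsingleton

/-- Property `(T₂)`: every simple non-trivial geodesic triangle is contained in one piece. -/
def PropT2 {Y : Type*} [MetricSpace Y] (P : Set (Set Y)) : Prop :=
  ∀ (v : Fin 3 → Y) (q : Fin 3 → Set Y), IsSimpleTriangle v q → ∃ B ∈ P, (⋃ i, q i) ⊆ B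

/-- The data defining an asymptotic cone of `X`: a non-principal ultrafilter on `ℕ`, a sequence of
observation centres `e` and a scaling sequence `d` of positive numbers with `lim_ω d = ∞`. -/
structure ConeData (X : Type*) where
  ω : Ultrafilter ℕ
  nonprincipal : (ω : Filter ℕ) ≤ cofinite
  e : ℕ → X
  d : ℕ → ℝ
  d_pos : ∀ n, 0 < d n
  d_tendsto : Tendsto d ω atTop

namespace ConeData

variable {X : Type*} [MetricSpace X]

/-- Sequences in `X` staying at distance `O(d n)` from the observation centres, `ω`-almost surely. -/
structure BddSeq (C : ConeData X) where
  seq : ℕ → X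
  bdd : ∃ M : ℝ, ∀ᶠ n in (C.ω : Filter ℕ), dist (seq n) (C.e n) ≤ M * C.d n

/-- `lim_ω dist (x n) (y n) / d n`; the limit exists, see `tendsto_limDist`. -/
noncomputable def limDist (C : ConeData X) (x y : C.BddSeq) : ℝ :=
  limUnder (C.ω : Filter ℕ) fun n => dist (x.seq n) (y.seq n) / C.d n

theorem tendsto_limDist (C : ConeData X) (x y : C.BddSeq) :
    Tendsto (fun n => dist (x.seq n) (y.seq n) / C.d n) C.ω (𝓝 (C.limDist x y)) := by
  obtain ⟨M, hM⟩ := x.bdd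
  obtain ⟨N, hN⟩ := y.bdd
  have h : ∀ᶠ n in (C.ω : Filter ℕ),
      dist (x.seq n) (y.seq n) / C.d n ∈ Icc (0 : ℝ) (M + N) := by
    filter_upwards [hM, hN] with n h1 h2
    refine ⟨div_nonneg dist_nonneg (C.d_pos n).le, ?_⟩
    rw [div_le_iff₀ (C.d_pos n)]
    calc dist (x.seq n) (y.seq n) ≤ dist (x.seq n) (C.e n) + dist (y.seq n) (C.e n) :=
          dist_triangle_right _ _ _
      _ ≤ (M + N) * C.d n := by linarith
  obtain ⟨l, -, hl⟩ := (isCompact_Icc (a := (0 : ℝ)) (b := M + N)).ultrafilter_le_nhds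
    (C.ω.map fun n => dist (x.seq n) (y.seq n) / C.d n) (le_principal_iff.2 h)
  exact tendsto_nhds_limUnder ⟨l, hl⟩

noncomputable instance (C : ConeData X) : PseudoMetricSpace C.BddSeq where
  dist := C.limDist
  dist_self x := by
    refine tendsto_nhds_unique (C.tendsto_limDist x x) ?_
    simp
  dist_comm x y := by
    refine tendsto_nhds_unique (C.tendsto_limDist x y) ?_
    simpa only [dist_comm] using C.tendsto_limDist y x
  dist_triangle x y z := by
    refine le_of_tendsto_of_tendsto' (C.tendsto_limDist x z)
      ((C.tendsto_limDist x y).add (C.tendsto_limDist y z)) fun n => ?_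
    rw [← add_div]
    exact div_le_div_of_nonneg_right (dist_triangle _ _ _) (C.d_pos n).le

/-- The asymptotic cone: bounded sequences modulo the relation `lim_ω dist (x n) (y n) / d n = 0`,
with the metric `lim_ω dist (x n) (y n) / d n`. -/
abbrev Cone (C : ConeData X) : Type _ := SeparationQuotient C.BddSeq

/-- The point of the cone represented by a sequence. -/
noncomputable def limPt (C : ConeData X) (x : C.BddSeq) : C.Cone := SeparationQuotient.mk x

theorem dist_limPt (C : ConeData X) (x y : C.BddSeq) :
    dist (C.limPt x) (C.limPt y) = C.limDist x y := rfl

/-- The limit subset of a sequence of subsets of `X`. -/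
def limSet (C : ConeData X) (A : ℕ → Set X) : Set C.Cone :=
  {p | ∃ a : C.BddSeq, (∀ᶠ n in (C.ω : Filter ℕ), a.seq n ∈ A n) ∧ C.limPt a = p}

/-- `s` is a limit geodesic from `p` to `p'`: a geodesic of the cone that is the limit
set of a sequence of geodesics of `X`. -/
def IsLimitGeodesic (C : ConeData X) (p p' : C.Cone) (s : Set C.Cone) : Prop :=
  IsGeodesicSegment p p' s ∧ ∃ g : ℕ → Set X,
    (∀ n, ∃ x y : X, IsGeodesicSegment x y (g n)) ∧ C.limSet g = s

/-- Property `(Π₃)`: every simple non-trivial triangle whose edges are limit geodesics is contained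
in one piece. -/
def PropPi3 (C : ConeData X) (P : Set (Set C.Cone)) : Prop :=
  ∀ (v : Fin 3 → C.Cone) (q : Fin 3 → Set C.Cone), IsSimpleTriangle v q →
    (∀ i, C.IsLimitGeodesic (v i) (v (i + 1)) (q i)) → ∃ B ∈ P, (⋃ i, q i) ⊆ B

/-- The collection of limit subsets of a family `A` of subsets of `X`: all limit sets of sequences
`A (i n)` with `dist (e n, A (i n)) ≤ M d n` `ω`-almost surely for some `M`. The distance is taken
in `[0, ∞]`, so that the empty set is infinitely far away. -/
def limitCollection {ι : Type*} (C : ConeData X) (A : ι → Set X) : Set (Set C.Cone) :=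
  {B | ∃ i : ℕ → ι, (∃ M : ℝ, ∀ᶠ n in (C.ω : Filter ℕ),
    Metric.infEDist (C.e n) (A (i n)) ≤ ENNReal.ofReal (M * C.d n)) ∧
    B = C.limSet fun n => A (i n)}

end ConeData

/-- `γ` restricted to `[a, b]` is an isometric embedding. -/
def IsGeodesicOn {Y : Type*} [MetricSpace Y] (γ : ℝ → Y) (a b : ℝ) : Prop :=
  ∀ t ∈ Icc a b, ∀ t' ∈ Icc a b, dist (γ t) (γ t') = |t - t'|

section Geodesics

variable {Y : Type*} [MetricSpace Y] {γ η : ℝ → Y} {a b c u v : ℝ} {x y : Y} {s s' : Set Y}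

namespace IsGeodesicOn

theorem mono (h : IsGeodesicOn γ a b) (hu : a ≤ u) (hv : v ≤ b) : IsGeodesicOn γ u v :=
  fun t ht t' ht' => h t ⟨hu.trans ht.1, ht.2.trans hv⟩ t' ⟨hu.trans ht'.1, ht'.2.trans hv⟩

theorem dist_eq (h : IsGeodesicOn γ a b) (hu : a ≤ u) (huv : u ≤ v) (hv : v ≤ b) :
    dist (γ u) (γ v) = v - u := by
  rw [h u ⟨hu, huv.trans hv⟩ v ⟨hu.trans huv, hv⟩, abs_sub_comm, abs_of_nonneg (by linarith)]

theorem injOn (h : IsGeodesicOn γ a b) : InjOn γ (Icc a b) := by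
  intro t ht t' ht' e
  have := h t ht t' ht'
  rw [e, dist_self] at this
  linarith [abs_eq_zero.1 this.symm]

theorem continuousOn (h : IsGeodesicOn γ a b) : ContinuousOn γ (Icc a b) := by
  have : LipschitzOnWith 1 γ (Icc a b) :=
    LipschitzOnWith.of_dist_le_mul fun t ht t' ht' => by
      rw [h t ht t' ht', Real.dist_eq]; simp
  exact this.continuousOn

/-- A `1`-Lipschitz curve joining points at the maximal possible distance is a geodesic. -/
theorem of_le (h : ∀ t t', a ≤ t → t ≤ t' → t' ≤ b → dist (γ t) (γ t') ≤ t' - t)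
    (hab : b - a ≤ dist (γ a) (γ b)) : IsGeodesicOn γ a b := by
  have key : ∀ t t', a ≤ t → t ≤ t' → t' ≤ b → dist (γ t) (γ t') = t' - t := by
    intro t t' h1 h2 h3
    refine le_antisymm (h t t' h1 h2 h3) ?_
    have e1 := h a t le_rfl h1 (h2.trans h3)
    have e2 := h t' b (h1.trans h2) h3 le_rfl
    have := dist_triangle4 (γ a) (γ t) (γ t') (γ b)
    linarith
  intro t ht t' ht'
  rcases le_total t t' with h1 | h1
  · rw [key t t' ht.1 h1 ht'.2, abs_sub_comm, abs_of_nonneg (by linarith)]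
  · rw [dist_comm, key t' t ht'.1 h1 ht.2, abs_of_nonneg (by linarith)]

theorem comp_add (h : IsGeodesicOn γ a b) (c : ℝ) :
    IsGeodesicOn (fun t => γ (t + c)) (a - c) (b - c) := by
  intro t ht t' ht'
  have := h (t + c) ⟨by linarith [ht.1], by linarith [ht.2]⟩ (t' + c)
    ⟨by linarith [ht'.1], by linarith [ht'.2]⟩
  simpa using this

theorem reverse (h : IsGeodesicOn γ a b) (c : ℝ) :
    IsGeodesicOn (fun t => γ (c - t)) (c - b) (c - a) := by
  intro t ht t' ht'
  have := h (c - t) ⟨by linarith [ht.2], by linarith [ht.1]⟩ (c - t')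
    ⟨by linarith [ht'.2], by linarith [ht'.1]⟩
  rw [this, abs_sub_comm]
  congr 1
  ring

theorem isGeodesicSegment (h : IsGeodesicOn γ a b) (hab : a ≤ b) :
    IsGeodesicSegment (γ a) (γ b) (γ '' Icc a b) := by
  have hd := h.dist_eq le_rfl hab le_rfl
  refine ⟨fun t => γ (t + a), by simp, by simp [hd], ?_, ?_⟩
  · have := h.comp_add a
    rw [sub_self] at this
    rw [hd]
    exact this
  · rw [hd, show (fun t => γ (t + a)) = γ ∘ (fun t => t + a) from rfl, image_comp]
    simp

theorem isGeodesicSegment_symm (h : IsGeodesicOn γ a b) (hab : a ≤ b) :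
    IsGeodesicSegment (γ b) (γ a) (γ '' Icc a b) := by
  have := (h.reverse (a + b)).isGeodesicSegment (by linarith)
  rw [show (fun t => γ (a + b - t)) = γ ∘ (fun t => a + b - t) from rfl, image_comp] at this
  simpa using this

/-- Geodesics with a common origin can only meet at points with the same parameter. -/
theorem param_eq_left (h : IsGeodesicOn γ a b) (h' : IsGeodesicOn η a c) (e : γ a = η a)
    (hu : u ∈ Icc a b) (hv : v ∈ Icc a c) (huv : γ u = η v) : u = v := by
  have h1 := h.dist_eq le_rfl hu.1 hu.2
  have h2 := h'.dist_eq le_rfl hv.1 hv.2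
  rw [← huv, ← e] at h2
  linarith

theorem param_eq_right (h : IsGeodesicOn γ a c) (h' : IsGeodesicOn η b c) (e : γ c = η c)
    (hu : u ∈ Icc a c) (hv : v ∈ Icc b c) (huv : γ u = η v) : u = v := by
  have h1 := h.dist_eq hu.1 hu.2 le_rfl
  have h2 := h'.dist_eq hv.1 hv.2 le_rfl
  rw [← huv, ← e] at h2
  linarith

/-- Replacing a part of a geodesic by another geodesic with the same endpoints. -/
theorem splice (h : IsGeodesicOn γ a b) (h' : IsGeodesicOn η u v) (hau : a ≤ u) (huv : u ≤ v)
    (hvb : v ≤ b) (eu : η u = γ u) (ev : η v = γ v) :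
    ∃ κ : ℝ → Y, IsGeodesicOn κ a b ∧ EqOn κ γ (Icc a u) ∧ EqOn κ η (Icc u v) ∧
      EqOn κ γ (Icc v b) := by
  classical
  let κ : ℝ → Y := fun t => if t ∈ Icc u v then η t else γ t
  have k2 : EqOn κ η (Icc u v) := fun t ht => if_pos ht
  have k1 : EqOn κ γ (Icc a u) := by
    intro t ht
    by_cases h1 : t ∈ Icc u v
    · have : t = u := le_antisymm ht.2 h1.1
      subst this
      exact (k2 h1).trans eu
    · exact if_neg h1
  have k3 : EqOn κ γ (Icc v b) := by
    intro t ht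
    by_cases h1 : t ∈ Icc u v
    · have : t = v := le_antisymm h1.2 ht.1
      subst this
      exact (k2 h1).trans ev
    · exact if_neg h1
  refine ⟨κ, of_le ?_ ?_, k1, k2, k3⟩
  · have d1 : ∀ t t', a ≤ t → t ≤ t' → t' ≤ u → dist (κ t) (κ t') = t' - t := fun t t' h1 h2 h3 => by
      rw [k1 ⟨h1, h2.trans h3⟩, k1 ⟨h1.trans h2, h3⟩, h.dist_eq h1 h2 (by linarith)]
    have d2 : ∀ t t', u ≤ t → t ≤ t' → t' ≤ v → dist (κ t) (κ t') = t' - t := fun t t' h1 h2 h3 => by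
      rw [k2 ⟨h1, h2.trans h3⟩, k2 ⟨h1.trans h2, h3⟩, h'.dist_eq h1 h2 h3]
    have d3 : ∀ t t', v ≤ t → t ≤ t' → t' ≤ b → dist (κ t) (κ t') = t' - t := fun t t' h1 h2 h3 => by
      rw [k3 ⟨h1, h2.trans h3⟩, k3 ⟨h1.trans h2, h3⟩, h.dist_eq (by linarith) h2 h3]
    intro t t' h1 h2 h3
    rcases le_total t' u with h4 | h4
    · exact (d1 t t' h1 h2 h4).le
    rcases le_total v t with h5 | h5
    · exact (d3 t t' h5 h2 h3).le
    rcases le_total t u with h6 | h6 <;> rcases le_total t' v with h7 | h7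
    · have := d1 t u h1 h6 le_rfl
      have := d2 u t' le_rfl h4 h7
      linarith [dist_triangle (κ t) (κ u) (κ t')]
    · have := d1 t u h1 h6 le_rfl
      have := d2 u v le_rfl huv le_rfl
      have := d3 v t' le_rfl h7 h3
      linarith [dist_triangle4 (κ t) (κ u) (κ v) (κ t')]
    · exact (d2 t t' h6 h2 h7).le
    · have := d2 t v h6 h5 le_rfl
      have := d3 v t' le_rfl h7 h3
      linarith [dist_triangle (κ t) (κ v) (κ t')]
  · rw [k1 ⟨le_rfl, hau⟩, k3 ⟨hvb, le_rfl⟩, h.dist_eq le_rfl (by linarith) le_rfl]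

end IsGeodesicOn

theorem IsGeodesicSegment.exists_isGeodesicOn (h : IsGeodesicSegment x y s)
    (hab : b - a = dist x y) :
    ∃ γ : ℝ → Y, IsGeodesicOn γ a b ∧ γ a = x ∧ γ b = y ∧ γ '' Icc a b = s := by
  obtain ⟨γ, h0, h1, h2, h3⟩ := h
  have hγ : IsGeodesicOn γ 0 (dist x y) := h2
  have e1 : 0 - -a = a := by ring
  have e2 : dist x y - -a = b := by linarith
  have := hγ.comp_add (-a)
  rw [e1, e2] at this
  refine ⟨_, this, by simp [h0], ?_, ?_⟩
  · simp only [← sub_eq_add_neg, hab, h1]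
  · rw [show (fun t => γ (t + -a)) = γ ∘ (fun t => t + -a) from rfl, image_comp]
    rw [image_add_const_Icc, ← sub_eq_add_neg, ← sub_eq_add_neg, sub_self, hab, h3]

theorem IsGeodesicSegment.exists_param (h : IsGeodesicSegment x y s) :
    ∃ L : ℝ, 0 ≤ L ∧ ∃ γ : ℝ → Y, IsGeodesicOn γ 0 L ∧ γ 0 = x ∧ γ L = y ∧ γ '' Icc 0 L = s :=
  ⟨dist x y, dist_nonneg, h.exists_isGeodesicOn (sub_zero _)⟩

theorem IsGeodesicSegment.symm (h : IsGeodesicSegment x y s) : IsGeodesicSegment y x s := by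
  obtain ⟨L, hL, γ, hγ, rfl, rfl, rfl⟩ := h.exists_param
  exact hγ.isGeodesicSegment_symm hL

theorem IsGeodesicSegment.left_mem (h : IsGeodesicSegment x y s) : x ∈ s := by
  obtain ⟨L, hL, γ, hγ, rfl, rfl, rfl⟩ := h.exists_param
  exact ⟨_, ⟨le_rfl, hL⟩, rfl⟩

theorem IsGeodesicSegment.right_mem (h : IsGeodesicSegment x y s) : y ∈ s :=
  h.symm.left_mem

theorem IsGeodesicSegment.exists_subsegment (h : IsGeodesicSegment x y s) {x' y' : Y}
    (hx : x' ∈ s) (hy : y' ∈ s) : ∃ s' ⊆ s, IsGeodesicSegment x' y' s' := by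
  obtain ⟨L, hL, γ, hγ, rfl, rfl, rfl⟩ := h.exists_param
  obtain ⟨t, ht, rfl⟩ := hx
  obtain ⟨t', ht', rfl⟩ := hy
  rcases le_total t t' with h1 | h1
  · exact ⟨_, image_mono (Icc_subset_Icc ht.1 ht'.2),
      (hγ.mono ht.1 ht'.2).isGeodesicSegment h1⟩
  · exact ⟨_, image_mono (Icc_subset_Icc ht'.1 ht.2),
      (hγ.mono ht'.1 ht.2).isGeodesicSegment_symm h1⟩

theorem IsGeodesicSegment.dist_add_dist (h : IsGeodesicSegment x y s) {z : Y} (hz : z ∈ s) :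
    dist x z + dist z y = dist x y := by
  obtain ⟨L, hL, γ, hγ, rfl, rfl, rfl⟩ := h.exists_param
  obtain ⟨t, ht, rfl⟩ := hz
  rw [hγ.dist_eq le_rfl ht.1 ht.2, hγ.dist_eq ht.1 ht.2 le_rfl,
    hγ.dist_eq le_rfl hL le_rfl]
  ring

theorem IsGeodesicSegment.exists_mem_dist_eq (h : IsGeodesicSegment x y s) {r : ℝ} (h0 : 0 ≤ r)
    (hr : r ≤ dist x y) : ∃ z ∈ s, dist x z = r := by
  obtain ⟨L, hL, γ, hγ, rfl, rfl, rfl⟩ := h.exists_param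
  rw [hγ.dist_eq le_rfl hL le_rfl, sub_zero] at hr
  refine ⟨γ r, ⟨r, ⟨h0, hr⟩, rfl⟩, ?_⟩
  rw [hγ.dist_eq le_rfl h0 hr, sub_zero]

/-- A geodesic contains only one geodesic between two given points. -/
theorem IsGeodesicSegment.subset_of_subset (h : IsGeodesicSegment x y s) {x' y' : Y}
    {s₁ s₂ : Set Y} (h₁ : IsGeodesicSegment x' y' s₁) (h₂ : IsGeodesicSegment x' y' s₂)
    (hs₁ : s₁ ⊆ s) (hs₂ : s₂ ⊆ s) : s₁ ⊆ s₂ := by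
  intro z hz
  have hz1 := h₁.dist_add_dist hz
  obtain ⟨w, hw, hwz⟩ := h₂.exists_mem_dist_eq (r := dist x' z) dist_nonneg
    (by linarith [dist_nonneg (x := z) (y := y')])
  have hw1 := h₂.dist_add_dist hw
  suffices z = w by rwa [this]
  obtain ⟨L, hL, γ, hγ, rfl, rfl, rfl⟩ := h.exists_param
  obtain ⟨t, ht, rfl⟩ := hs₁ h₁.left_mem
  obtain ⟨t', ht', rfl⟩ := hs₁ h₁.right_mem
  obtain ⟨r, hr, rfl⟩ := hs₁ hz
  obtain ⟨r', hr', rfl⟩ := hs₂ hw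
  rw [hγ t ht r hr, hγ r hr t' ht', hγ t ht t' ht'] at hz1
  rw [hγ t ht r' hr', hγ t ht r hr] at hwz
  rw [hγ t ht r' hr', hγ r' hr' t' ht', hγ t ht t' ht'] at hw1
  have : r = r' := by
    rcases abs_cases (t - r) with h1 | h1 <;> rcases abs_cases (t - r') with h2 | h2 <;>
    rcases abs_cases (r - t') with h3 | h3 <;> rcases abs_cases (r' - t') with h4 | h4 <;>
    rcases abs_cases (t - t') with h5 | h5 <;> linarith
  rw [this]

theorem IsGeodesicSegment.isCompact (h : IsGeodesicSegment x y s) : IsCompact s := by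
  obtain ⟨L, hL, γ, hγ, rfl, rfl, rfl⟩ := h.exists_param
  exact isCompact_Icc.image_of_continuousOn hγ.continuousOn

theorem isSimpleTriangle_of {x y z : Y} {s₀ s₁ s₂ : Set Y} (h₀ : IsGeodesicSegment x y s₀)
    (h₁ : IsGeodesicSegment y z s₁) (h₂ : IsGeodesicSegment z x s₂) (h01 : s₀ ∩ s₁ ⊆ {y})
    (h12 : s₁ ∩ s₂ ⊆ {z}) (h20 : s₂ ∩ s₀ ⊆ {x}) (hxy : x ≠ y) :
    IsSimpleTriangle ![x, y, z] ![s₀, s₁, s₂] := by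
  refine ⟨?_, ?_, ?_⟩
  · intro i
    fin_cases i
    · exact h₀
    · exact h₁
    · exact h₂
  · intro i
    fin_cases i
    · exact h01.antisymm (singleton_subset_iff.2 ⟨h₀.right_mem, h₁.left_mem⟩)
    · exact h12.antisymm (singleton_subset_iff.2 ⟨h₁.right_mem, h₂.left_mem⟩)
    · exact h20.antisymm (singleton_subset_iff.2 ⟨h₂.right_mem, h₀.left_mem⟩)
  · exact ⟨x, mem_iUnion.2 ⟨0, h₀.left_mem⟩, y, mem_iUnion.2 ⟨0, h₀.right_mem⟩, hxy⟩

theorem IsSimpleTriangle.vertex_ne {v : Fin 3 → Y} {q : Fin 3 → Set Y} (h : IsSimpleTriangle v q)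
    (i : Fin 3) : v i ≠ v (i + 1) := by
  obtain ⟨hq, hmeet, x, hx, y, hy, hxy⟩ := h
  have h3 : ∀ i : Fin 3, i + 1 + 1 + 1 = i := by decide
  have hcases : ∀ i j : Fin 3, j = i ∨ j = i + 1 ∨ j = i + 1 + 1 := by decide
  intro e
  have e1 : v (i + 1) = v (i + 1 + 1) := by
    have h1 : v i ∈ q (i + 1 + 1) := by simpa only [h3] using (hq (i + 1 + 1)).right_mem
    have : v (i + 1) ∈ q (i + 1) ∩ q (i + 1 + 1) := ⟨(hq (i + 1)).left_mem, e ▸ h1⟩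
    rwa [hmeet (i + 1)] at this
  have hv : ∀ j, v j = v i := by
    intro j
    rcases hcases i j with rfl | rfl | rfl
    exacts [rfl, e.symm, e1.symm.trans e.symm]
  have hall : ∀ z ∈ ⋃ i, q i, z = v i := by
    intro z hz
    obtain ⟨j, hj⟩ := mem_iUnion.1 hz
    have h1 := (hq j).dist_add_dist hj
    rw [hv j, hv (j + 1), dist_self] at h1
    exact (dist_le_zero.1 (by linarith [dist_nonneg (x := z) (y := v i)])).symm
  exact hxy ((hall x hx).trans (hall y hy).symm)

theorem IsSimpleTriangle.vertex_notMem {v : Fin 3 → Y} {q : Fin 3 → Set Y}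
    (h : IsSimpleTriangle v q) (i : Fin 3) : v i ∉ q (i + 1) := by
  have h3 : ∀ i : Fin 3, i + 1 + 1 + 1 = i := by decide
  intro hi
  have h1 : v i ∈ q (i + 1 + 1) := by simpa only [h3] using (h.1 (i + 1 + 1)).right_mem
  have h2 : v i ∈ q (i + 1) ∩ q (i + 1 + 1) := ⟨hi, h1⟩
  rw [h.2.1] at h2
  refine h.vertex_ne (i + 1 + 1) ?_
  rw [h3]
  exact h2.symm

/-- The connected component of a point in the complement of a closed set of reals. -/
theorem IsClosed.exists_component {K : Set ℝ} (hK : IsClosed K) {r : ℝ} (ha : a ∈ K) (hb : b ∈ K)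
    (har : a ≤ r) (hrb : r ≤ b) (hr : r ∉ K) :
    ∃ u ∈ K, ∃ v ∈ K, a ≤ u ∧ u < r ∧ r < v ∧ v ≤ b ∧ ∀ t ∈ Ioo u v, t ∉ K := by
  obtain ⟨u, ⟨hu, hua, hur⟩, hu'⟩ := ((isCompact_Icc (a := a) (b := r)).inter_left hK).exists_isGreatest
    ⟨a, ha, le_rfl, har⟩
  obtain ⟨v, ⟨hv, hrv, hvb⟩, hv'⟩ := ((isCompact_Icc (a := r) (b := b)).inter_left hK).exists_isLeast
    ⟨b, hb, hrb, le_rfl⟩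
  refine ⟨u, hu, v, hv, hua, lt_of_le_of_ne hur ?_, lt_of_le_of_ne hrv ?_, hvb, ?_⟩
  · rintro rfl; exact hr hu
  · rintro rfl; exact hr hv
  · intro t ht htK
    rcases le_total t r with h | h
    · exact absurd (hu' ⟨htK, hua.trans ht.1.le, h⟩) (not_le.2 ht.1)
    · exact absurd (hv' ⟨htK, h, ht.2.le.trans hvb⟩) (not_le.2 ht.2)

end Geodesics

/-- A class of subsets closed under taking subsegments of its geodesics. -/
def SubsegmentClosed {Y : Type*} [MetricSpace Y] (E : Set (Set Y)) : Prop :=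
  ∀ (γ : ℝ → Y) (a b u v : ℝ), IsGeodesicOn γ a b → γ '' Icc a b ∈ E → a ≤ u → u ≤ v → v ≤ b →
    γ '' Icc u v ∈ E

/-- Every simple triangle with edges in the three given classes is contained in a piece. -/
def PropPi {Y : Type*} [MetricSpace Y] (P E₀ E₁ E₂ : Set (Set Y)) : Prop :=
  ∀ (v : Fin 3 → Y) (q : Fin 3 → Set Y), IsSimpleTriangle v q → q 0 ∈ E₀ → q 1 ∈ E₁ → q 2 ∈ E₂ →
    ∃ B ∈ P, (⋃ i, q i) ⊆ B

/-- Locally on `(a, b)` and away from the coincidences of `γ` and `η`, the two curves lie in a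
common piece. -/
def BigonRel {Y : Type*} (P : Set (Set Y)) (γ η : ℝ → Y) (a b : ℝ) : Prop :=
  ∀ s ∈ Ioo a b, γ s ≠ η s → ∃ B ∈ P, ∀ᶠ t in 𝓝 s, γ t ∈ B ∧ η t ∈ B

section Pieces

variable {Y : Type*} {P : Set (Set Y)} {γ η κ : ℝ → Y} {a b m u v s : ℝ}
  {B B' : Set Y}

theorem PropT1.eq_of_mem (hT : PropT1 P) (hB : B ∈ P) (hB' : B' ∈ P) {x y : Y} (hx : x ∈ B)
    (hx' : x ∈ B') (hy : y ∈ B) (hy' : y ∈ B') (hxy : x ≠ y) : B = B' := by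
  by_contra h
  exact hxy (hT B hB B' hB' h ⟨hx, hx'⟩ ⟨hy, hy'⟩)

namespace BigonRel

theorem symm (h : BigonRel P γ η a b) : BigonRel P η γ a b := fun s hs hne => by
  obtain ⟨B, hB, h1⟩ := h s hs hne.symm
  exact ⟨B, hB, h1.mono fun t ht => ht.symm⟩

theorem mono (h : BigonRel P γ η a b) (hu : a ≤ u) (hv : v ≤ b) : BigonRel P γ η u v :=
  fun s hs => h s ⟨hu.trans_lt hs.1, hs.2.trans_le hv⟩

theorem of_eqOn (h : EqOn γ η (Ioo a b)) : BigonRel P γ η a b :=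
  fun _ hs hne => absurd (h hs) hne

theorem join (h : BigonRel P γ η a m) (h' : BigonRel P γ η m b) (e : γ m = η m) :
    BigonRel P γ η a b := by
  intro s hs hne
  rcases lt_trichotomy s m with h1 | rfl | h1
  · exact h s ⟨hs.1, h1⟩ hne
  · exact absurd e hne
  · exact h' s ⟨h1, hs.2⟩ hne

end BigonRel

variable [MetricSpace Y]

theorem PropT1.eq_of_eventually (hT : PropT1 P) (hγ : IsGeodesicOn γ a b) (hs : s ∈ Ioo a b)
    (hB : B ∈ P) (hB' : B' ∈ P) (h : ∀ᶠ t in 𝓝 s, γ t ∈ B) (h' : ∀ᶠ t in 𝓝 s, γ t ∈ B') :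
    B = B' := by
  have h1 : ∀ᶠ t in 𝓝[≠] s, (γ t ∈ B ∧ γ t ∈ B') ∧ t ∈ Ioo a b :=
    ((h.and h').and (isOpen_Ioo.mem_nhds hs)).filter_mono nhdsWithin_le_nhds
  obtain ⟨t, ⟨⟨h2, h3⟩, h4⟩, h5⟩ := (h1.and self_mem_nhdsWithin).exists
  refine hT.eq_of_mem hB hB' h2 h3 h.self_of_nhds h'.self_of_nhds fun e => h5 ?_
  exact hγ.injOn (Ioo_subset_Icc_self h4) (Ioo_subset_Icc_self hs) e

/-- A geodesic which is locally contained in pieces is contained in one piece. -/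
theorem PropT1.exists_piece (hT : PropT1 P) (hγ : IsGeodesicOn γ a b) (hab : a < b)
    (h : ∀ s ∈ Ioo a b, ∃ B ∈ P, ∀ᶠ t in 𝓝 s, γ t ∈ B) :
    ∃ B ∈ P, ∀ s ∈ Ioo a b, ∀ᶠ t in 𝓝 s, γ t ∈ B := by
  obtain ⟨m, hm⟩ := nonempty_Ioo.2 hab
  obtain ⟨B, hB, hmB⟩ := h m hm
  refine ⟨B, hB, isPreconnected_Ioo.subset_of_closure_inter_subset
    (isOpen_setOfPred_eventually_nhds (p := fun t => γ t ∈ B)) ⟨m, hm, hmB⟩ ?_⟩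
  rintro s ⟨hs, hsab⟩
  obtain ⟨B', hB', hsB'⟩ := h s hsab
  obtain ⟨t, ⟨ht1, ht2⟩, ht3⟩ := mem_closure_iff_nhds.1 hs _
    (inter_mem (eventually_eventually_nhds.2 hsB') (isOpen_Ioo.mem_nhds hsab))
  rw [hT.eq_of_eventually hγ ht2 hB hB' ht3 ht1]
  exact hsB'

theorem IsGeodesicOn.mem_of_Ioo (hγ : IsGeodesicOn γ a b) (hab : a < b) (hB : IsClosed B)
    (h : ∀ s ∈ Ioo a b, γ s ∈ B) : ∀ s ∈ Icc a b, γ s ∈ B := by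
  have h1 : MapsTo γ (Ioo a b) B := h
  have h2 := h1.closure_of_continuousOn (by rw [closure_Ioo hab.ne]; exact hγ.continuousOn)
  rwa [closure_Ioo hab.ne, hB.closure_eq] at h2

namespace BigonRel

/-- If `γ` is in a piece near a point, then so is `η`. -/
theorem eventually_mem (hT : PropT1 P) (hγ : IsGeodesicOn γ a b) (h : BigonRel P γ η a b)
    (hB : B ∈ P) (hs : s ∈ Ioo a b) (hsB : ∀ᶠ t in 𝓝 s, γ t ∈ B) : ∀ᶠ t in 𝓝 s, η t ∈ B := by
  filter_upwards [eventually_eventually_nhds.2 hsB, isOpen_Ioo.mem_nhds hs] with t ht ht'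
  by_cases e : γ t = η t
  · rw [← e]; exact ht.self_of_nhds
  · obtain ⟨B', hB', h1⟩ := h t ht' e
    rw [hT.eq_of_eventually hγ ht' hB hB' ht (h1.mono fun _ => And.left)]
    exact h1.self_of_nhds.2

theorem trans (hT : PropT1 P) (hη : IsGeodesicOn η a b) (h : BigonRel P γ η a b)
    (h' : BigonRel P η κ a b) : BigonRel P γ κ a b := by
  intro s hs hne
  have : ∃ B ∈ P, ∀ᶠ t in 𝓝 s, η t ∈ B := by
    by_cases e : γ s = η s
    · obtain ⟨B, hB, h1⟩ := h' s hs fun e' => hne (e.trans e')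
      exact ⟨B, hB, h1.mono fun _ => And.left⟩
    · obtain ⟨B, hB, h1⟩ := h s hs e
      exact ⟨B, hB, h1.mono fun _ => And.right⟩
  obtain ⟨B, hB, h1⟩ := this
  exact ⟨B, hB, (h.symm.eventually_mem hT hη hB hs h1).and (h'.eventually_mem hT hη hB hs h1)⟩

theorem exists_piece (hT : PropT1 P) (h : BigonRel P γ η a b) (hγ : IsGeodesicOn γ a b)
    (hau : a ≤ u) (huv : u < v) (hvb : v ≤ b) (hne : ∀ s ∈ Ioo u v, γ s ≠ η s) :
    ∃ B ∈ P, ∀ s ∈ Ioo u v, γ s ∈ B ∧ η s ∈ B := by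
  have h' := h.mono hau hvb
  have hγ' := hγ.mono hau hvb
  obtain ⟨B, hB, h1⟩ := hT.exists_piece hγ' huv fun s hs => by
    obtain ⟨B, hB, h1⟩ := h' s hs (hne s hs)
    exact ⟨B, hB, h1.mono fun _ => And.left⟩
  exact ⟨B, hB, fun s hs => ⟨(h1 s hs).self_of_nhds,
    (h'.eventually_mem hT hγ' hB hs (h1 s hs)).self_of_nhds⟩⟩

/-- If `γ` is contained in a closed piece, then so is `η`. -/
theorem forall_mem (hT : PropT1 P) (h : BigonRel P γ η a b) (hγ : IsGeodesicOn γ a b)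
    (hη : IsGeodesicOn η a b) (ea : γ a = η a) (hB : B ∈ P) (hBc : IsClosed B)
    (hγB : ∀ s ∈ Icc a b, γ s ∈ B) : ∀ s ∈ Icc a b, η s ∈ B := by
  intro s hs
  rcases (hs.1.trans hs.2).eq_or_lt with e | hab
  · have : s = a := le_antisymm (hs.2.trans e.symm.le) hs.1
    rw [this, ← ea]
    exact hγB a ⟨le_rfl, e.le⟩
  · refine hη.mem_of_Ioo hab hBc (fun t ht => ?_) s hs
    refine (h.eventually_mem hT hγ hB ht ?_).self_of_nhds
    filter_upwards [isOpen_Ioo.mem_nhds ht] with r hr using hγB r (Ioo_subset_Icc_self hr)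

end BigonRel

theorem PropPi.rotate {E₀ E₁ E₂ : Set (Set Y)} (h : PropPi P E₀ E₁ E₂) : PropPi P E₁ E₂ E₀ := by
  intro v q hq h0 h1 h2
  have hq' : IsSimpleTriangle (fun i => v (i + 2)) (fun i => q (i + 2)) := by
    refine ⟨fun i => ?_, fun i => ?_, ?_⟩
    · have := hq.1 (i + 2)
      rwa [add_right_comm] at this
    · have := hq.2.1 (i + 2)
      rwa [add_right_comm] at this
    · obtain ⟨x, hx, y, hy, hxy⟩ := hq.2.2
      refine ⟨x, ?_, y, ?_, hxy⟩
      · obtain ⟨i, hi⟩ := mem_iUnion.1 hx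
        refine mem_iUnion.2 ⟨i + 1, ?_⟩
        rwa [show i + 1 + 2 = i by rw [add_assoc]; exact add_zero i]
      · obtain ⟨i, hi⟩ := mem_iUnion.1 hy
        refine mem_iUnion.2 ⟨i + 1, ?_⟩
        rwa [show i + 1 + 2 = i by rw [add_assoc]; exact add_zero i]
  obtain ⟨B, hB, h3⟩ := h _ _ hq' h2 h0 h1
  refine ⟨B, hB, iUnion_subset fun i => ?_⟩
  have := (subset_iUnion (fun i => q (i + 2)) (i + 1)).trans h3
  rwa [show i + 1 + 2 = i by rw [add_assoc]; exact add_zero i] at this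

theorem PropPi.exists_piece {E₀ E₁ E₂ : Set (Set Y)} (h : PropPi P E₀ E₁ E₂) {x y z : Y}
    {s₀ s₁ s₂ : Set Y} (h₀ : IsGeodesicSegment x y s₀)
    (h₁ : IsGeodesicSegment y z s₁) (h₂ : IsGeodesicSegment z x s₂) (h01 : s₀ ∩ s₁ ⊆ {y})
    (h12 : s₁ ∩ s₂ ⊆ {z}) (h20 : s₂ ∩ s₀ ⊆ {x}) (hxy : x ≠ y) (e₀ : s₀ ∈ E₀) (e₁ : s₁ ∈ E₁)
    (e₂ : s₂ ∈ E₂) : ∃ B ∈ P, s₀ ⊆ B ∧ s₁ ⊆ B ∧ s₂ ⊆ B := by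
  obtain ⟨B, hB, hs⟩ := h _ _ (isSimpleTriangle_of h₀ h₁ h₂ h01 h12 h20 hxy) e₀ e₁ e₂
  exact ⟨B, hB, (subset_iUnion ![s₀, s₁, s₂] 0).trans hs, (subset_iUnion ![s₀, s₁, s₂] 1).trans hs,
    (subset_iUnion ![s₀, s₁, s₂] 2).trans hs⟩

/-- Two geodesics with the same endpoints, one in the class `E` and the other a concatenation of
two geodesics in `E`. -/
theorem bigonRel_of_break {E : Set (Set Y)} (hE : SubsegmentClosed E) (hPi : PropPi P E E E)
    (hγ : IsGeodesicOn γ a b) (hη : IsGeodesicOn η a b) (ea : γ a = η a) (eb : γ b = η b)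
    (ham : a ≤ m) (hmb : m ≤ b) (hγ₁ : γ '' Icc a m ∈ E) (hγ₂ : γ '' Icc m b ∈ E)
    (hηE : η '' Icc a b ∈ E) : BigonRel P γ η a b := by
  intro s hs hne
  have hc : ContinuousOn (fun t => (γ t, η t)) (Icc a b) := hγ.continuousOn.prodMk hη.continuousOn
  have hK : IsClosed (Icc a b ∩ (fun t => (γ t, η t)) ⁻¹' {p | p.1 = p.2}) :=
    hc.preimage_isClosed_of_isClosed isClosed_Icc (isClosed_eq continuous_fst continuous_snd)
  have hab : a ≤ b := ham.trans hmb
  obtain ⟨u, ⟨-, hu⟩, v, ⟨-, hv⟩, hau, hus, hsv, hvb, huv⟩ := hK.exists_component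
    (a := a) (b := b) ⟨⟨le_rfl, hab⟩, ea⟩ ⟨⟨hab, le_rfl⟩, eb⟩ hs.1.le hs.2.le fun h => hne h.2
  change γ u = η u at hu
  change γ v = η v at hv
  have huv' : ∀ t ∈ Ioo u v, γ t ≠ η t := fun t ht e =>
    huv t ht ⟨⟨hau.trans ht.1.le, ht.2.le.trans hvb⟩, e⟩
  obtain ⟨r, hur, hrv, h1, h2⟩ : ∃ r, u < r ∧ r < v ∧ γ '' Icc u r ∈ E ∧ γ '' Icc r v ∈ E := by
    rcases le_or_gt m u with h | h
    · exact ⟨s, hus, hsv, hE γ m b u s (hγ.mono ham le_rfl) hγ₂ h hus.le (hsv.le.trans hvb),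
        hE γ m b s v (hγ.mono ham le_rfl) hγ₂ (h.trans hus.le) hsv.le hvb⟩
    rcases le_or_gt v m with h' | h'
    · exact ⟨s, hus, hsv, hE γ a m u s (hγ.mono le_rfl hmb) hγ₁ hau hus.le (hsv.le.trans h'),
        hE γ a m s v (hγ.mono le_rfl hmb) hγ₁ (hau.trans hus.le) hsv.le h'⟩
    · exact ⟨m, h, h', hE γ a m u m (hγ.mono le_rfl hmb) hγ₁ hau h.le le_rfl,
        hE γ m b m v (hγ.mono ham le_rfl) hγ₂ le_rfl h'.le hvb⟩
  have hγ' := hγ.mono hau hvb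
  have hη' := hη.mono hau hvb
  have hmeet : ∀ t ∈ Icc u v, ∀ t' ∈ Icc u v, γ t = η t' → t = u ∨ t = v := by
    intro t ht t' ht' e
    have := hγ'.param_eq_left hη' hu ht ht' e
    subst this
    by_contra! h
    exact huv' t ⟨lt_of_le_of_ne ht.1 h.1.symm, lt_of_le_of_ne ht.2 h.2⟩ e
  have hs2 := hη'.isGeodesicSegment_symm (hus.trans hsv).le
  rw [← hu, ← hv] at hs2
  obtain ⟨B, hB, hB0, hB1, hB2⟩ := hPi.exists_piece
    ((hγ'.mono le_rfl hrv.le).isGeodesicSegment hur.le)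
    ((hγ'.mono hur.le le_rfl).isGeodesicSegment hrv.le) hs2
    (by
      rintro _ ⟨⟨t, ht, rfl⟩, t', ht', e⟩
      have : t' = t := hγ'.injOn ⟨hur.le.trans ht'.1, ht'.2⟩ ⟨ht.1, ht.2.trans hrv.le⟩ e
      subst this
      rw [le_antisymm ht.2 ht'.1]; rfl)
    (by
      rintro _ ⟨⟨t, ht, rfl⟩, t', ht', e⟩
      rcases hmeet t ⟨hur.le.trans ht.1, ht.2⟩ t' ht' e.symm with h | h
      · exact absurd (h ▸ ht.1) (not_le.2 hur)
      · rw [h]; rfl)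
    (by
      rintro _ ⟨⟨t', ht', e⟩, t, ht, rfl⟩
      rcases hmeet t ⟨ht.1, ht.2.trans hrv.le⟩ t' ht' e.symm with h | h
      · rw [h]; rfl
      · exact absurd (h ▸ ht.2) (not_le.2 hrv))
    (fun e => hur.ne (hγ'.injOn ⟨le_rfl, (hur.trans hrv).le⟩ ⟨hur.le, hrv.le⟩ e))
    h1 h2 (hE η a b u v hη hηE hau (hus.trans hsv).le hvb)
  refine ⟨B, hB, ?_⟩
  filter_upwards [isOpen_Ioo.mem_nhds (⟨hus, hsv⟩ : s ∈ Ioo u v)] with t ht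
  refine ⟨?_, hB2 ⟨t, Ioo_subset_Icc_self ht, rfl⟩⟩
  rcases le_total t r with h | h
  · exact hB0 ⟨t, ⟨ht.1.le, h⟩, rfl⟩
  · exact hB1 ⟨t, ⟨h, ht.2.le⟩, rfl⟩

/-- A geodesic can be modified, keeping four of its points, to a concatenation of three geodesics
in the class `E`. -/
theorem exists_broken {E : Set (Set Y)} (hex : ∀ x y : Y, ∃ s ∈ E, IsGeodesicSegment x y s)
    (hγ : IsGeodesicOn γ a b) (hau : a ≤ u) (huv : u ≤ v) (hvb : v ≤ b) :
    ∃ κ : ℝ → Y, IsGeodesicOn κ a b ∧ κ a = γ a ∧ κ u = γ u ∧ κ v = γ v ∧ κ b = γ b ∧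
      κ '' Icc a u ∈ E ∧ κ '' Icc u v ∈ E ∧ κ '' Icc v b ∈ E := by
  have key : ∀ r t, a ≤ r → r ≤ t → t ≤ b → ∃ η : ℝ → Y, IsGeodesicOn η r t ∧ η r = γ r ∧
      η t = γ t ∧ η '' Icc r t ∈ E := by
    intro r t h1 h2 h3
    obtain ⟨s, hsE, hs⟩ := hex (γ r) (γ t)
    obtain ⟨η, h4, h5, h6, h7⟩ := hs.exists_isGeodesicOn (hγ.dist_eq h1 h2 h3).symm
    exact ⟨η, h4, h5, h6, h7 ▸ hsE⟩
  obtain ⟨η₁, g₁, l₁, r₁, m₁⟩ := key a u le_rfl hau (huv.trans hvb)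
  obtain ⟨η₂, g₂, l₂, r₂, m₂⟩ := key u v hau huv hvb
  obtain ⟨η₃, g₃, l₃, r₃, m₃⟩ := key v b (hau.trans huv) hvb le_rfl
  obtain ⟨κ₁, k₁, -, e₁, e₁'⟩ := hγ.splice g₁ le_rfl hau (huv.trans hvb) l₁ r₁
  obtain ⟨κ₂, k₂, e₂, e₂', e₂''⟩ := k₁.splice g₂ hau huv hvb
    (l₂.trans (e₁' ⟨le_rfl, huv.trans hvb⟩).symm) (r₂.trans (e₁' ⟨huv, hvb⟩).symm)
  obtain ⟨κ₃, k₃, e₃, e₃', -⟩ := k₂.splice g₃ (hau.trans huv) hvb le_rfl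
    (l₃.trans ((e₂' ⟨huv, le_rfl⟩).trans r₂).symm)
    (r₃.trans ((e₂'' ⟨hvb, le_rfl⟩).trans (e₁' ⟨huv.trans hvb, le_rfl⟩)).symm)
  have f₁ : EqOn κ₃ η₁ (Icc a u) := fun t ht => by
    rw [e₃ ⟨ht.1, ht.2.trans huv⟩, e₂ ht, e₁ ht]
  have f₂ : EqOn κ₃ η₂ (Icc u v) := fun t ht => by
    rw [e₃ ⟨hau.trans ht.1, ht.2⟩, e₂' ht]
  exact ⟨κ₃, k₃, (f₁ ⟨le_rfl, hau⟩).trans l₁, (f₁ ⟨hau, le_rfl⟩).trans r₁,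
    (f₂ ⟨huv, le_rfl⟩).trans r₂, (e₃' ⟨hvb, le_rfl⟩).trans r₃, f₁.image_eq ▸ m₁, f₂.image_eq ▸ m₂,
    EqOn.image_eq e₃' ▸ m₃⟩

end Pieces

section Replacement

variable {Y : Type*} [MetricSpace Y] {P E : Set (Set Y)} {γ η : ℝ → Y} {a b : ℝ}

theorem bigonRel_broken (hT : PropT1 P) (hE : SubsegmentClosed E)
    (hex : ∀ x y : Y, ∃ s ∈ E, IsGeodesicSegment x y s) (hPi : PropPi P E E E)
    {u v : ℝ} (hγ : IsGeodesicOn γ a b) (hη : IsGeodesicOn η a b) (ea : γ a = η a) (eb : γ b = η b)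
    (hηE : η '' Icc a b ∈ E) (hau : a ≤ u) (huv : u ≤ v) (hvb : v ≤ b)
    (h₁ : γ '' Icc a u ∈ E) (h₂ : γ '' Icc u v ∈ E) (h₃ : γ '' Icc v b ∈ E) :
    BigonRel P γ η a b := by
  obtain ⟨s, hsE, hs⟩ := hex (γ a) (γ v)
  obtain ⟨κ, k1, k2, k3, rfl⟩ :=
    hs.exists_isGeodesicOn (hγ.dist_eq le_rfl (hau.trans huv) hvb).symm
  obtain ⟨σ, s1, -, s2, s3⟩ := hγ.splice k1 le_rfl (hau.trans huv) hvb k2 k3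
  have ha := s2 ⟨le_rfl, hau.trans huv⟩
  have hv := s2 ⟨hau.trans huv, le_rfl⟩
  have r1 : BigonRel P γ σ a v :=
    bigonRel_of_break hE hPi (hγ.mono le_rfl hvb) (s1.mono le_rfl hvb) (k2.symm.trans ha.symm)
      (k3.symm.trans hv.symm) hau huv h₁ h₂ (s2.image_eq ▸ hsE)
  have r2 : BigonRel P γ σ v b := BigonRel.of_eqOn fun t ht => (s3 (Ioo_subset_Icc_self ht)).symm
  have r3 : BigonRel P σ η a b :=
    bigonRel_of_break hE hPi s1 hη ((ha.trans k2).trans ea) ((s3 ⟨hvb, le_rfl⟩).trans eb)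
      (hau.trans huv) hvb (s2.image_eq ▸ hsE) (s3.image_eq ▸ h₃) hηE
  exact (r1.join r2 (s3 ⟨le_rfl, hvb⟩).symm).trans hT s1 r3

/-- An arbitrary geodesic compared with a geodesic in the class `E`. -/
theorem bigonRel_of_mem (hT : PropT1 P) (hE : SubsegmentClosed E)
    (hex : ∀ x y : Y, ∃ s ∈ E, IsGeodesicSegment x y s) (hPi : PropPi P E E E)
    (hγ : IsGeodesicOn γ a b) (hη : IsGeodesicOn η a b) (ea : γ a = η a) (eb : γ b = η b)
    (hηE : η '' Icc a b ∈ E) : BigonRel P γ η a b := by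
  intro s hs hne
  have hd : 0 < dist (γ s) (η s) := dist_pos.2 hne
  obtain ⟨r, hr, hrd, hra, hrb⟩ : ∃ r, 0 < r ∧ 2 * r ≤ dist (γ s) (η s) ∧ a ≤ s - r ∧ s + r ≤ b := by
    refine ⟨min (dist (γ s) (η s) / 2) (min (s - a) (b - s)), ?_, ?_, ?_, ?_⟩
    · exact lt_min (by linarith) (lt_min (by linarith [hs.1]) (by linarith [hs.2]))
    · linarith [min_le_left (dist (γ s) (η s) / 2) (min (s - a) (b - s))]
    · linarith [min_le_right (dist (γ s) (η s) / 2) (min (s - a) (b - s)),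
        min_le_left (s - a) (b - s)]
    · linarith [min_le_right (dist (γ s) (η s) / 2) (min (s - a) (b - s)),
        min_le_right (s - a) (b - s)]
  have hsr : s ∈ Ioo (s - r) (s + r) := ⟨by linarith, by linarith⟩
  have key : ∀ t ∈ Ioo (s - r) (s + r), ∃ B ∈ P, γ t ∈ B ∧ ∀ t' ∈ Ioo (s - r) (s + r), η t' ∈ B := by
    intro t ht
    obtain ⟨κ, k, ka, kb, ks, kt, hrel⟩ : ∃ κ : ℝ → Y, IsGeodesicOn κ a b ∧ κ a = γ a ∧ κ b = γ b ∧
        κ s = γ s ∧ κ t = γ t ∧ BigonRel P κ η a b := by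
      rcases le_total s t with h | h
      · obtain ⟨κ, k, k1, k2, k3, k4, k5, k6, k7⟩ := exists_broken hex hγ hs.1.le h
          (ht.2.le.trans hrb)
        exact ⟨κ, k, k1, k4, k2, k3, bigonRel_broken hT hE hex hPi k hη (k1.trans ea) (k4.trans eb)
          hηE hs.1.le h (ht.2.le.trans hrb) k5 k6 k7⟩
      · obtain ⟨κ, k, k1, k2, k3, k4, k5, k6, k7⟩ := exists_broken hex hγ (hra.trans ht.1.le) h
          hs.2.le
        exact ⟨κ, k, k1, k4, k3, k2, bigonRel_broken hT hE hex hPi k hη (k1.trans ea) (k4.trans eb)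
          hηE (hra.trans ht.1.le) h hs.2.le k5 k6 k7⟩
    obtain ⟨B, hB, hBt⟩ := hrel.exists_piece hT k hra (by linarith) hrb fun t' ht' e => by
      have h1 := k s (Ioo_subset_Icc_self hs) t' ⟨hra.trans ht'.1.le, ht'.2.le.trans hrb⟩
      have h2 := hη t' ⟨hra.trans ht'.1.le, ht'.2.le.trans hrb⟩ s (Ioo_subset_Icc_self hs)
      have h3 : |s - t'| < r := abs_lt.2 ⟨by linarith [ht'.2], by linarith [ht'.1]⟩
      rw [abs_sub_comm] at h2
      have h4 := dist_triangle (γ s) (κ t') (η s)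
      rw [← ks, h1, e, h2, ks] at h4
      linarith
    exact ⟨B, hB, kt ▸ (hBt t ht).1, fun t' ht' => (hBt t' ht').2⟩
  obtain ⟨B, hB, -, hη'⟩ := key s hsr
  refine ⟨B, hB, ?_⟩
  filter_upwards [isOpen_Ioo.mem_nhds hsr] with t ht
  obtain ⟨B', hB', h1, h2⟩ := key t ht
  have hs' : s + r / 2 ∈ Ioo (s - r) (s + r) := ⟨by linarith, by linarith⟩
  rw [hT.eq_of_mem hB hB' (hη' s hsr) (h2 s hsr) (hη' _ hs') (h2 _ hs') fun e => ?_]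
  · exact ⟨h1, h2 t ht⟩
  · have := hη.injOn ⟨hs.1.le, hs.2.le⟩ ⟨by linarith [hs.1], by linarith⟩ e
    linarith

theorem bigonRel_of_geodesics (hT : PropT1 P) (hE : SubsegmentClosed E)
    (hex : ∀ x y : Y, ∃ s ∈ E, IsGeodesicSegment x y s) (hPi : PropPi P E E E)
    (hγ : IsGeodesicOn γ a b) (hη : IsGeodesicOn η a b) (ea : γ a = η a) (eb : γ b = η b) :
    BigonRel P γ η a b := by
  rcases le_or_gt b a with h | h
  · exact fun s hs => absurd (hs.1.trans hs.2) (not_lt.2 h)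
  · obtain ⟨s, hsE, hs⟩ := hex (γ a) (γ b)
    obtain ⟨κ, k1, k2, k3, rfl⟩ := hs.exists_isGeodesicOn (hγ.dist_eq le_rfl h.le le_rfl).symm
    have h1 : BigonRel P γ κ a b := bigonRel_of_mem hT hE hex hPi hγ k1 k2.symm k3.symm hsE
    have h2 : BigonRel P η κ a b :=
      bigonRel_of_mem hT hE hex hPi hη k1 (ea.symm.trans k2.symm) (eb.symm.trans k3.symm) hsE
    exact h1.trans hT k1 h2.symm

theorem PropPi.replace_edge (hT : PropT1 P) (hP : ∀ B ∈ P, IsClosed B)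
    (hex : ∀ x y : Y, ∃ s ∈ E, IsGeodesicSegment x y s)
    (hrel : ∀ (γ η : ℝ → Y) (a b : ℝ), IsGeodesicOn γ a b → IsGeodesicOn η a b → γ a = η a →
      γ b = η b → BigonRel P γ η a b) {E₁ E₂ : Set (Set Y)} (hE : SubsegmentClosed E)
    (hE₁ : SubsegmentClosed E₁) (hE₂ : SubsegmentClosed E₂)
    (hPi : PropPi P E E₁ E₂) : PropPi P univ E₁ E₂ := by
  rintro v q ⟨hq, hmeet, hnt⟩ - hq1 hq2
  have g0 : IsGeodesicSegment (v 0) (v 1) (q 0) := hq 0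
  have g1 : IsGeodesicSegment (v 1) (v 2) (q 1) := hq 1
  have g2 : IsGeodesicSegment (v 2) (v 0) (q 2) := hq 2
  have m01 : q 0 ∩ q 1 = {v 1} := hmeet 0
  have m12 : q 1 ∩ q 2 = {v 2} := hmeet 1
  have m20 : q 2 ∩ q 0 = {v 0} := hmeet 2
  have hv01 : v 0 ≠ v 1 := IsSimpleTriangle.vertex_ne ⟨hq, hmeet, hnt⟩ 0
  obtain ⟨L, hL⟩ : ∃ L, L = dist (v 0) (v 1) := ⟨_, rfl⟩
  have hLpos : 0 < L := hL ▸ dist_pos.2 hv01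
  obtain ⟨s, hsE, hs⟩ := hex (v 0) (v 1)
  obtain ⟨p, p_geo, p0, pL, pim⟩ := g0.exists_isGeodesicOn (a := 0) (b := L) (by linarith)
  obtain ⟨h, h_geo, h0, hL', him⟩ := hs.exists_isGeodesicOn (a := 0) (b := L) (by linarith)
  obtain ⟨c, hc⟩ : ∃ c, c = L - dist (v 2) (v 1) := ⟨_, rfl⟩
  obtain ⟨d, hd⟩ : ∃ d, d = dist (v 0) (v 2) := ⟨_, rfl⟩
  have hcL : c ≤ L := by linarith [dist_nonneg (x := v 2) (y := v 1)]
  have hd0 : 0 ≤ d := hd ▸ dist_nonneg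
  obtain ⟨k, k_geo, kc, kL, kim⟩ := g1.symm.exists_isGeodesicOn (a := c) (b := L) (by linarith)
  obtain ⟨l, l_geo, l0, ld, lim⟩ := g2.symm.exists_isGeodesicOn (a := 0) (b := d) (by linarith)
  have hk : ∀ t ∈ Icc 0 L, h t ∈ q 1 → c ≤ t ∧ h t = k t := by
    intro t ht hm
    rw [← kim] at hm
    obtain ⟨t', ht', e⟩ := hm
    have := h_geo.param_eq_right k_geo (hL'.trans kL.symm) ht ht' e.symm
    subst this
    exact ⟨ht'.1, e.symm⟩
  have hl : ∀ t ∈ Icc 0 L, h t ∈ q 2 → t ≤ d ∧ h t = l t := by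
    intro t ht hm
    rw [← lim] at hm
    obtain ⟨t', ht', e⟩ := hm
    have := h_geo.param_eq_left l_geo (h0.trans l0.symm) ht ht' e.symm
    subst this
    exact ⟨ht'.2, e.symm⟩
  have hK : ∀ i, IsClosed (Icc 0 L ∩ h ⁻¹' q i) := fun i =>
    h_geo.continuousOn.preimage_isClosed_of_isClosed isClosed_Icc (hq i).isCompact.isClosed
  have h0q : h 0 ∈ q 2 := by rw [h0]; exact g2.right_mem
  have hLq : h L ∈ q 1 := by rw [hL']; exact g1.left_mem
  obtain ⟨α, ⟨hα, hαq⟩, hα'⟩ := (isCompact_Icc.of_isClosed_subset (hK 2)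
    inter_subset_left).exists_isGreatest ⟨0, ⟨le_rfl, hLpos.le⟩, h0q⟩
  obtain ⟨β, ⟨⟨hβ, hβq⟩, hαβ⟩, hβ'⟩ := ((isCompact_Icc.of_isClosed_subset (hK 1)
    inter_subset_left).inter_right (isClosed_Ici (a := α))).exists_isLeast
      ⟨L, ⟨⟨hLpos.le, le_rfl⟩, hLq⟩, hα.2⟩
  change h α ∈ q 2 at hαq
  change h β ∈ q 1 at hβq
  change α ≤ β at hαβ
  obtain ⟨hαd, hαl⟩ := hl α hα hαq
  obtain ⟨hcβ, hβk⟩ := hk β hβ hβq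
  have tri : α < β → ∃ B ∈ P, h '' Icc α β ⊆ B ∧ k '' Icc c β ⊆ B ∧ l '' Icc α d ⊆ B := by
    intro hlt
    have s1 := (k_geo.mono le_rfl hβ.2).isGeodesicSegment_symm hcβ
    have s2 := (l_geo.mono hα.1 le_rfl).isGeodesicSegment_symm hαd
    rw [kc, ← hβk] at s1
    rw [ld, ← hαl] at s2
    refine hPi.exists_piece ((h_geo.mono hα.1 hβ.2).isGeodesicSegment hαβ) s1 s2 ?_ ?_ ?_
      (fun e => hlt.ne (h_geo.injOn hα hβ e))
      (hE h 0 L α β h_geo (him ▸ hsE) hα.1 hαβ hβ.2)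
      (hE₁ k c L c β k_geo (kim ▸ hq1) le_rfl hcβ hβ.2)
      (hE₂ l 0 d α d l_geo (lim ▸ hq2) hα.1 hαd le_rfl)
    · rintro _ ⟨⟨t, ht, rfl⟩, t', ht', e⟩
      have h1 : h t ∈ q 1 := by
        rw [← e, ← kim]; exact ⟨t', ⟨ht'.1, ht'.2.trans hβ.2⟩, rfl⟩
      have h2 := hβ' ⟨⟨⟨hα.1.trans ht.1, ht.2.trans hβ.2⟩, h1⟩, ht.1⟩
      rw [le_antisymm ht.2 h2]; rfl
    · rw [← m12, ← kim, ← lim]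
      exact inter_subset_inter (image_mono (Icc_subset_Icc_right hβ.2))
        (image_mono (Icc_subset_Icc_left hα.1))
    · rintro _ ⟨⟨t', ht', e⟩, t, ht, rfl⟩
      have h1 : h t ∈ q 2 := by
        rw [← e, ← lim]; exact ⟨t', ⟨hα.1.trans ht'.1, ht'.2⟩, rfl⟩
      have h2 := hα' ⟨⟨hα.1.trans ht.1, ht.2.trans hβ.2⟩, h1⟩
      rw [le_antisymm h2 ht.1]; rfl
  have r0 : BigonRel P h p 0 L := hrel h p 0 L h_geo p_geo (h0.trans p0.symm) (hL'.trans pL.symm)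
  have r1 : BigonRel P h k β L := hrel h k β L (h_geo.mono hβ.1 le_rfl) (k_geo.mono hcβ le_rfl) hβk
    (hL'.trans kL.symm)
  have r2 : BigonRel P h l 0 α := hrel h l 0 α (h_geo.mono le_rfl hα.2) (l_geo.mono le_rfl hαd)
    (h0.trans l0.symm) hαl
  obtain ⟨B, hB, hhB⟩ := hT.exists_piece h_geo hLpos fun t ht => by
    by_cases e : h t = p t
    swap
    · obtain ⟨B, hB, h1⟩ := r0 t ht e
      exact ⟨B, hB, h1.mono fun _ => And.left⟩
    have hpt : h t ∈ q 0 := by rw [e, ← pim]; exact ⟨t, Ioo_subset_Icc_self ht, rfl⟩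
    have n1 : h t ∉ q 1 := fun h1 => by
      have : h t ∈ q 0 ∩ q 1 := ⟨hpt, h1⟩
      rw [m01, ← hL'] at this
      exact ht.2.ne (h_geo.injOn (Ioo_subset_Icc_self ht) ⟨hLpos.le, le_rfl⟩ this)
    have n2 : h t ∉ q 2 := fun h1 => by
      have : h t ∈ q 2 ∩ q 0 := ⟨h1, hpt⟩
      rw [m20, ← h0] at this
      exact ht.1.ne' (h_geo.injOn (Ioo_subset_Icc_self ht) ⟨le_rfl, hLpos.le⟩ this)
    rcases lt_trichotomy t α with h1 | rfl | h1
    · obtain ⟨B, hB, h3⟩ := r2 t ⟨ht.1, h1⟩ fun e' => n2 (by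
        rw [e', ← lim]; exact ⟨t, ⟨ht.1.le, h1.le.trans hαd⟩, rfl⟩)
      exact ⟨B, hB, h3.mono fun _ => And.left⟩
    · exact absurd hαq n2
    rcases lt_trichotomy t β with h2 | rfl | h2
    · obtain ⟨B, hB, h3, -⟩ := tri (h1.trans h2)
      refine ⟨B, hB, ?_⟩
      filter_upwards [isOpen_Ioo.mem_nhds (⟨h1, h2⟩ : t ∈ Ioo α β)] with r hr using
        h3 ⟨r, Ioo_subset_Icc_self hr, rfl⟩
    · exact absurd hβq n1
    · obtain ⟨B, hB, h3⟩ := r1 t ⟨h2, ht.2⟩ fun e' => n1 (by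
        rw [e', ← kim]; exact ⟨t, ⟨hcβ.trans h2.le, ht.2.le⟩, rfl⟩)
      exact ⟨B, hB, h3.mono fun _ => And.left⟩
  have hBc := hP B hB
  have hhB' : ∀ t ∈ Icc 0 L, h t ∈ B :=
    h_geo.mem_of_Ioo hLpos hBc fun t ht => (hhB t ht).self_of_nhds
  have hpB : ∀ t ∈ Icc 0 L, p t ∈ B :=
    r0.forall_mem hT h_geo p_geo (h0.trans p0.symm) hB hBc hhB'
  have hkB : ∀ t ∈ Icc β L, k t ∈ B :=
    r1.forall_mem hT (h_geo.mono hβ.1 le_rfl) (k_geo.mono hcβ le_rfl) hβk hB hBc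
      fun t ht => hhB' t ⟨hβ.1.trans ht.1, ht.2⟩
  have hlB : ∀ t ∈ Icc 0 α, l t ∈ B :=
    r2.forall_mem hT (h_geo.mono le_rfl hα.2) (l_geo.mono le_rfl hαd) (h0.trans l0.symm) hB hBc
      fun t ht => hhB' t ⟨ht.1, ht.2.trans hα.2⟩
  have hrest : (∀ t ∈ Icc c β, k t ∈ B) ∧ ∀ t ∈ Icc α d, l t ∈ B := by
    rcases hαβ.eq_or_lt with rfl | hlt
    · have h1 : h α ∈ q 1 ∩ q 2 := ⟨hβq, hαq⟩
      rw [m12] at h1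
      have h2 : c = α := k_geo.injOn ⟨le_rfl, hcL⟩ ⟨hcβ, hβ.2⟩ (by rw [kc, ← hβk]; exact h1.symm)
      have h3 : d = α := l_geo.injOn ⟨hd0, le_rfl⟩ ⟨hα.1, hαd⟩ (by rw [ld, ← hαl]; exact h1.symm)
      refine ⟨fun t ht => ?_, fun t ht => ?_⟩
      · exact hkB t ⟨h2.symm.le.trans ht.1, ht.2.trans hβ.2⟩
      · exact hlB t ⟨hα.1.trans ht.1, ht.2.trans h3.le⟩
    · obtain ⟨B', hB', h1, h2, h3⟩ := tri hlt
      have : B = B' := hT.eq_of_mem hB hB' (hhB' α hα) (h1 ⟨α, ⟨le_rfl, hαβ⟩, rfl⟩) (hhB' β hβ)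
        (h1 ⟨β, ⟨hαβ, le_rfl⟩, rfl⟩) fun e => hlt.ne (h_geo.injOn hα hβ e)
      rw [this]
      exact ⟨fun t ht => h2 ⟨t, ht, rfl⟩, fun t ht => h3 ⟨t, ht, rfl⟩⟩
  refine ⟨B, hB, iUnion_subset fun i => ?_⟩
  fin_cases i
  · change q 0 ⊆ B
    rw [← pim]
    rintro _ ⟨t, ht, rfl⟩
    exact hpB t ht
  · change q 1 ⊆ B
    rw [← kim]
    rintro _ ⟨t, ht, rfl⟩
    rcases le_total t β with h1 | h1
    · exact hrest.1 t ⟨ht.1, h1⟩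
    · exact hkB t ⟨h1, ht.2⟩
  · change q 2 ⊆ B
    rw [← lim]
    rintro _ ⟨t, ht, rfl⟩
    rcases le_total t α with h1 | h1
    · exact hlB t ⟨ht.1, h1⟩
    · exact hrest.2 t ⟨h1, ht.2⟩

/-- If the simple triangles with edges in a sufficiently rich class of geodesics are contained in
pieces, then so are all simple geodesic triangles. -/
theorem propT2_of_propPi (hT : PropT1 P) (hP : ∀ B ∈ P, IsClosed B) (hE : SubsegmentClosed E)
    (hex : ∀ x y : Y, ∃ s ∈ E, IsGeodesicSegment x y s) (hPi : PropPi P E E E) : PropT2 P := by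
  have hrel := fun (γ η : ℝ → Y) (a b : ℝ) =>
    bigonRel_of_geodesics (γ := γ) (η := η) (a := a) (b := b) hT hE hex hPi
  have hu : SubsegmentClosed (univ : Set (Set Y)) := fun _ _ _ _ _ _ _ _ _ _ => mem_univ _
  have h1 := (hPi.replace_edge hT hP hex hrel hE hE hE).rotate
  have h2 := (h1.replace_edge hT hP hex hrel hE hE hu).rotate
  have h3 := h2.replace_edge hT hP hex hrel hE hu hu
  exact fun v q hq => h3 v q hq (mem_univ _) (mem_univ _) (mem_univ _)

end Replacement

namespace ConeData

theorem eventually_le_mul {X : Type*} {C : ConeData X} (K : ℝ) {ε : ℝ} (hε : 0 < ε) :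
    ∀ᶠ n in (C.ω : Filter ℕ), K ≤ ε * C.d n := by
  filter_upwards [C.d_tendsto.eventually_ge_atTop (K / ε)] with n hn
  rw [div_le_iff₀ hε] at hn
  linarith

variable {X : Type*} [MetricSpace X] {C : ConeData X}

theorem tendsto_dist_div (x y : C.BddSeq) :
    Tendsto (fun n => dist (x.seq n) (y.seq n) / C.d n) C.ω (𝓝 (dist (C.limPt x) (C.limPt y))) :=
  C.tendsto_limDist x y

theorem exists_limPt (p : C.Cone) : ∃ x : C.BddSeq, C.limPt x = p :=
  SeparationQuotient.surjective_mk p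

theorem exists_bddSeq (x : C.BddSeq) {y : ℕ → X} {M : ℝ}
    (h : ∀ᶠ n in (C.ω : Filter ℕ), dist (x.seq n) (y n) ≤ M * C.d n) :
    ∃ z : C.BddSeq, z.seq = y := by
  obtain ⟨N, hN⟩ := x.bdd
  refine ⟨⟨y, M + N, ?_⟩, rfl⟩
  filter_upwards [h, hN] with n h1 h2
  linarith [dist_triangle_left (y n) (C.e n) (x.seq n)]

theorem eventually_dist_le {x y : C.BddSeq} {r : ℝ} (h : dist (C.limPt x) (C.limPt y) < r) :
    ∀ᶠ n in (C.ω : Filter ℕ), dist (x.seq n) (y.seq n) ≤ r * C.d n := by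
  filter_upwards [(tendsto_dist_div x y).eventually_lt_const h] with n hn
  exact ((div_lt_iff₀ (C.d_pos n)).1 hn).le

theorem limPt_eq_of_eventually {x y : C.BddSeq}
    (h : ∀ ε > 0, ∀ᶠ n in (C.ω : Filter ℕ), dist (x.seq n) (y.seq n) ≤ ε * C.d n) :
    C.limPt x = C.limPt y := by
  refine dist_le_zero.1 (le_of_forall_pos_le_add fun ε hε => ?_)
  rw [zero_add]
  refine le_of_tendsto (tendsto_dist_div x y) ?_
  filter_upwards [h ε hε] with n hn
  rwa [div_le_iff₀ (C.d_pos n)]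

theorem mem_limSet_of_eventually {x : C.BddSeq} {A : ℕ → Set X}
    (h : ∀ ε > 0, ∀ᶠ n in (C.ω : Filter ℕ), ∃ a ∈ A n, dist (x.seq n) a ≤ ε * C.d n) :
    C.limPt x ∈ C.limSet A := by
  have h1 : ∀ᶠ n in (C.ω : Filter ℕ), ∃ a ∈ A n,
      dist (x.seq n) a < Metric.infDist (x.seq n) (A n) + 1 := by
    filter_upwards [h 1 one_pos] with n ⟨a, ha, _⟩
    exact (Metric.infDist_lt_iff ⟨a, ha⟩).1 (lt_add_one _)
  obtain ⟨a, ha⟩ := h1.choice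
  have h2 : ∀ ε > 0, ∀ᶠ n in (C.ω : Filter ℕ), dist (x.seq n) (a n) ≤ ε * C.d n := by
    intro ε hε
    filter_upwards [ha, h (ε / 2) (half_pos hε), eventually_le_mul 1 (half_pos hε)]
      with n h3 ⟨b, hb, hb'⟩ h5
    linarith [h3.2, Metric.infDist_le_dist_of_mem (x := x.seq n) hb]
  obtain ⟨z, rfl⟩ := exists_bddSeq x (h2 1 one_pos)
  exact ⟨z, ha.mono fun _ => And.left, (limPt_eq_of_eventually h2).symm⟩

theorem isClosed_limSet (A : ℕ → Set X) : IsClosed (C.limSet A) := by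
  refine isClosed_of_closure_subset fun p hp => ?_
  obtain ⟨x, rfl⟩ := exists_limPt p
  refine mem_limSet_of_eventually fun ε hε => ?_
  obtain ⟨_, ⟨a, ha, rfl⟩, hd⟩ := Metric.mem_closure_iff.1 hp ε hε
  filter_upwards [ha, eventually_dist_le hd] with n h1 h2 using ⟨_, h1, h2⟩

theorem limSet_subset_of_thickening {s A : ℕ → Set X} {χ : ℝ}
    (h : ∀ᶠ n in (C.ω : Filter ℕ), s n ⊆ Metric.thickening χ (A n)) :
    C.limSet s ⊆ C.limSet A := by
  rintro _ ⟨x, hx, rfl⟩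
  refine mem_limSet_of_eventually fun ε hε => ?_
  filter_upwards [h, hx, eventually_le_mul χ hε] with n h1 h2 h3
  obtain ⟨a, ha, hd⟩ := Metric.mem_thickening_iff.1 (h1 h2)
  exact ⟨a, ha, hd.le.trans h3⟩

theorem limSet_mono {s A : ℕ → Set X} (h : ∀ᶠ n in (C.ω : Filter ℕ), s n ⊆ A n) :
    C.limSet s ⊆ C.limSet A := by
  rintro _ ⟨x, hx, rfl⟩
  refine ⟨x, ?_, rfl⟩
  filter_upwards [h, hx] with n h1 h2 using h1 h2

theorem exists_forall_mem {A : ℕ → Set X} (hA : ∀ n, (A n).Nonempty) {p : C.Cone}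
    (hp : p ∈ C.limSet A) : ∃ a : C.BddSeq, (∀ n, a.seq n ∈ A n) ∧ C.limPt a = p := by
  classical
  obtain ⟨a, ha, rfl⟩ := hp
  choose b hb using hA
  have h : ∀ ε > 0, ∀ᶠ n in (C.ω : Filter ℕ),
      dist (a.seq n) (if a.seq n ∈ A n then a.seq n else b n) ≤ ε * C.d n := by
    intro ε hε
    filter_upwards [ha] with n hn
    rw [if_pos hn, dist_self]
    exact (mul_pos hε (C.d_pos n)).le
  obtain ⟨z, hz⟩ := exists_bddSeq a (h 1 one_pos)
  refine ⟨z, fun n => ?_, (limPt_eq_of_eventually (by rwa [hz])).symm⟩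
  rw [hz]
  by_cases hn : a.seq n ∈ A n
  · simp [hn]
  · simpa [hn] using hb n

theorem isGeodesicSegment_limSet (a b : C.BddSeq) {g : ℕ → Set X}
    (hg : ∀ n, IsGeodesicSegment (a.seq n) (b.seq n) (g n)) :
    IsGeodesicSegment (C.limPt a) (C.limPt b) (C.limSet g) := by
  choose γ h0 h1 hγ him using hg
  obtain ⟨ℓ, hℓ⟩ : ∃ ℓ : ℕ → ℝ, ∀ n, dist (a.seq n) (b.seq n) = ℓ n := ⟨_, fun n => rfl⟩
  simp only [hℓ] at h1 hγ him
  have hℓ0 : ∀ n, 0 ≤ ℓ n := fun n => hℓ n ▸ dist_nonneg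
  obtain ⟨L, hL⟩ : ∃ L, L = dist (C.limPt a) (C.limPt b) := ⟨_, rfl⟩
  have hℓL : Tendsto (fun n => ℓ n / C.d n) C.ω (𝓝 L) := by
    have := tendsto_dist_div a b
    simpa only [hℓ, ← hL] using this
  obtain ⟨m, hm⟩ : ∃ m : ℝ → ℕ → ℝ, ∀ t n, m t n = max 0 (min (t * C.d n) (ℓ n)) :=
    ⟨_, fun _ _ => rfl⟩
  have hm1 : ∀ t n, m t n ∈ Icc 0 (ℓ n) := fun t n => by
    rw [hm]
    exact ⟨le_max_left _ _, max_le (hℓ0 n) (min_le_right _ _)⟩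
  have hm2 : ∀ t ∈ Icc 0 L, Tendsto (fun n => m t n / C.d n) C.ω (𝓝 t) := by
    intro t ht
    have h3 : Tendsto (fun n => max 0 (min t (ℓ n / C.d n))) C.ω (𝓝 (max 0 (min t L))) :=
      tendsto_const_nhds.max (tendsto_const_nhds.min hℓL)
    rw [min_eq_left ht.2, max_eq_right ht.1] at h3
    refine h3.congr fun n => ?_
    have hd := C.d_pos n
    rw [hm, eq_div_iff hd.ne', max_mul_of_nonneg _ _ hd.le, zero_mul, min_mul_of_nonneg _ _ hd.le,
      div_mul_cancel₀ _ hd.ne']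
  have hγa : ∀ n, ∀ t ∈ Icc 0 (ℓ n), dist (a.seq n) (γ n t) = t := by
    intro n t ht
    rw [← h0 n, hγ n 0 ⟨le_rfl, hℓ0 n⟩ t ht, zero_sub, abs_neg, abs_of_nonneg ht.1]
  have hpt : ∀ t : ℝ, ∃ z : C.BddSeq, z.seq = fun n => γ n (m t n) := by
    intro t
    refine exists_bddSeq a (M := |t|) (Eventually.of_forall fun n => ?_)
    rw [hγa n _ (hm1 t n), hm]
    refine max_le (mul_nonneg (abs_nonneg _) (C.d_pos n).le) ((min_le_left _ _).trans ?_)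
    exact mul_le_mul_of_nonneg_right (le_abs_self t) (C.d_pos n).le
  choose z hz using hpt
  have hdist : ∀ (x y : C.BddSeq) (r r' : ℕ → ℝ) (t t' : ℝ),
      (∀ᶠ n in (C.ω : Filter ℕ), r n ∈ Icc 0 (ℓ n) ∧ x.seq n = γ n (r n)) →
      (∀ᶠ n in (C.ω : Filter ℕ), r' n ∈ Icc 0 (ℓ n) ∧ y.seq n = γ n (r' n)) →
      Tendsto (fun n => r n / C.d n) C.ω (𝓝 t) → Tendsto (fun n => r' n / C.d n) C.ω (𝓝 t') →
      dist (C.limPt x) (C.limPt y) = |t - t'| := by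
    intro x y r r' t t' hx hy hr hr'
    refine tendsto_nhds_unique (tendsto_dist_div x y) (((hr.sub hr').abs).congr' ?_)
    filter_upwards [hx, hy] with n h2 h3
    rw [h2.2, h3.2, hγ n _ h2.1 _ h3.1, ← sub_div, abs_div, abs_of_pos (C.d_pos n)]
  have hzev : ∀ t, ∀ᶠ n in (C.ω : Filter ℕ), m t n ∈ Icc 0 (ℓ n) ∧ (z t).seq n = γ n (m t n) :=
    fun t => Eventually.of_forall fun n => ⟨hm1 t n, by rw [hz]⟩
  have hL0 : 0 ≤ L := hL ▸ dist_nonneg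
  have haz : ∀ᶠ n in (C.ω : Filter ℕ), (0 : ℝ) ∈ Icc 0 (ℓ n) ∧ a.seq n = γ n 0 :=
    Eventually.of_forall fun n => ⟨⟨le_rfl, hℓ0 n⟩, (h0 n).symm⟩
  have ha0 : Tendsto (fun n => (0 : ℝ) / C.d n) C.ω (𝓝 0) := by simp
  refine ⟨fun t => C.limPt (z t), ?_, ?_, ?_, ?_⟩
  · rw [← dist_eq_zero, hdist _ _ _ _ 0 0 (hzev 0) haz (hm2 0 ⟨le_rfl, hL0⟩) ha0]
    simp
  · rw [← hL, ← dist_eq_zero, hdist _ b _ ℓ L L (hzev L)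
      (Eventually.of_forall fun n => ⟨⟨hℓ0 n, le_rfl⟩, (h1 n).symm⟩) (hm2 L ⟨hL0, le_rfl⟩) hℓL]
    simp
  · rw [← hL]
    exact fun t ht t' ht' => hdist _ _ _ _ t t' (hzev t) (hzev t') (hm2 t ht) (hm2 t' ht')
  · rw [← hL]
    refine Subset.antisymm ?_ ?_
    · rintro _ ⟨t, -, rfl⟩
      refine ⟨z t, Eventually.of_forall fun n => ?_, rfl⟩
      rw [hz, ← him n]
      exact ⟨_, hm1 t n, rfl⟩
    · rintro _ ⟨c, hc, rfl⟩
      have : ∀ᶠ n in (C.ω : Filter ℕ), ∃ r, r ∈ Icc 0 (ℓ n) ∧ c.seq n = γ n r := by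
        filter_upwards [hc] with n hn
        rw [← him n] at hn
        obtain ⟨r, hr, e⟩ := hn
        exact ⟨r, hr, e.symm⟩
      obtain ⟨r, hr⟩ := this.choice
      have ht : Tendsto (fun n => r n / C.d n) C.ω (𝓝 (dist (C.limPt a) (C.limPt c))) := by
        refine (tendsto_dist_div a c).congr' ?_
        filter_upwards [hr] with n hn
        rw [hn.2, hγa n _ hn.1]
      have htL : dist (C.limPt a) (C.limPt c) ∈ Icc 0 L := by
        refine ⟨dist_nonneg, le_of_tendsto_of_tendsto ht hℓL ?_⟩
        filter_upwards [hr] with n hn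
        exact div_le_div_of_nonneg_right hn.1.2 (C.d_pos n).le
      refine ⟨_, htL, ?_⟩
      rw [← dist_eq_zero, hdist _ _ _ _ _ _ (hzev _) hr (hm2 _ htL) ht]
      simp

/-- A geodesic contained in a limit geodesic is the limit of geodesics with converging endpoints. -/
theorem IsLimitGeodesic.exists_seq {p p' x y : C.Cone} {s s' : Set C.Cone}
    (h : C.IsLimitGeodesic p p' s) (hs : s' ⊆ s) (h' : IsGeodesicSegment x y s') :
    ∃ (a b : C.BddSeq) (g : ℕ → Set X), (∀ n, IsGeodesicSegment (a.seq n) (b.seq n) (g n)) ∧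
      C.limPt a = x ∧ C.limPt b = y ∧ C.limSet g = s' := by
  obtain ⟨hgeo, G, hG, rfl⟩ := h
  choose u v hG using hG
  have hne : ∀ n, (G n).Nonempty := fun n => ⟨_, (hG n).left_mem⟩
  obtain ⟨a, ha, rfl⟩ := exists_forall_mem hne (hs h'.left_mem)
  obtain ⟨b, hb, rfl⟩ := exists_forall_mem hne (hs h'.right_mem)
  choose g hg hg' using fun n => (hG n).exists_subsegment (ha n) (hb n)
  have h1 := isGeodesicSegment_limSet a b hg'
  have h2 : C.limSet g ⊆ C.limSet G := limSet_mono (Eventually.of_forall hg)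
  exact ⟨a, b, g, hg', rfl, rfl, Subset.antisymm (hgeo.subset_of_subset h1 h' h2 hs)
    (hgeo.subset_of_subset h' h1 hs h2)⟩

theorem propT2_of_propPi3 (hX : IsGeodesicSpace X) {P : Set (Set C.Cone)}
    (hP : ∀ B ∈ P, IsClosed B) (hT : PropT1 P) (hPi : C.PropPi3 P) : PropT2 P := by
  refine propT2_of_propPi (E := {s | ∃ p p', C.IsLimitGeodesic p p' s}) hT hP ?_ ?_ ?_
  · rintro γ a b u v hγ ⟨p, p', h⟩ hau huv hvb
    have h1 := (hγ.mono hau hvb).isGeodesicSegment huv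
    obtain ⟨x, y, g, hg, -, -, h2⟩ := h.exists_seq (image_mono (Icc_subset_Icc hau hvb)) h1
    exact ⟨_, _, h1, g, fun n => ⟨_, _, hg n⟩, h2⟩
  · intro p p'
    obtain ⟨a, rfl⟩ := exists_limPt p
    obtain ⟨b, rfl⟩ := exists_limPt p'
    choose g hg using fun n => hX (a.seq n) (b.seq n)
    have h1 := isGeodesicSegment_limSet a b hg
    exact ⟨C.limSet g, ⟨_, _, h1, g, fun n => ⟨_, _, hg n⟩, rfl⟩, h1⟩
  · rintro v q hq ⟨_, _, h0⟩ ⟨_, _, h1⟩ ⟨_, _, h2⟩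
    refine hPi v q hq fun i => ⟨hq.1 i, ?_⟩
    fin_cases i
    · exact h0.2
    · exact h1.2
    · exact h2.2

end ConeData

section FatHexagon

variable {X : Type*} [MetricSpace X]

/-- On a geodesic issued from `a`, the first point within distance `D` of a compact set. -/
theorem IsGeodesicSegment.exists_first {a b : X} {s t : Set X} (hs : IsGeodesicSegment a b s)
    (ht : IsCompact t) {D : ℝ} (ha : ∀ w ∈ t, D < dist a w) (hb : ∃ w ∈ t, dist b w ≤ D) :
    ∃ y ∈ s, ∃ x ∈ t, dist y x = D ∧ ∀ z ∈ s, dist a z ≤ dist a y → ∀ w ∈ t, D ≤ dist z w := by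
  obtain ⟨L, hL, γ, hγ, rfl, rfl, rfl⟩ := hs.exists_param
  obtain ⟨w₀, hw₀, hw₀D⟩ := hb
  have hne : t.Nonempty := ⟨w₀, hw₀⟩
  have hc : ContinuousOn (fun r => Metric.infDist (γ r) t) (Icc 0 L) :=
    (Metric.continuous_infDist_pt t).comp_continuousOn hγ.continuousOn
  have hK : IsCompact (Icc 0 L ∩ (fun r => Metric.infDist (γ r) t) ⁻¹' Iic D) :=
    isCompact_Icc.of_isClosed_subset (hc.preimage_isClosed_of_isClosed isClosed_Icc isClosed_Iic)
      inter_subset_left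
  obtain ⟨σ, ⟨hσ, hσD⟩, hmin⟩ := hK.exists_isLeast
    ⟨L, ⟨hL, le_rfl⟩, (Metric.infDist_le_dist_of_mem hw₀).trans hw₀D⟩
  change Metric.infDist (γ σ) t ≤ D at hσD
  have hlt : ∀ r ∈ Ico 0 σ, D ≤ Metric.infDist (γ r) t := fun r hr => by
    by_contra! h
    exact absurd (hmin ⟨⟨hr.1, hr.2.le.trans hσ.2⟩, h.le⟩) (not_le.2 hr.2)
  obtain ⟨x, hx, hxd⟩ := ht.exists_infDist_eq_dist hne (γ σ)
  have hσ0 : 0 < σ := by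
    refine lt_of_le_of_ne hσ.1 ?_
    rintro rfl
    exact absurd (hxd ▸ hσD) (not_le.2 (ha x hx))
  have hle : ∀ r ∈ Icc 0 σ, D ≤ Metric.infDist (γ r) t := by
    have h1 : MapsTo (fun r => Metric.infDist (γ r) t) (Ico 0 σ) (Ici D) := hlt
    have h2 := h1.closure_of_continuousOn (by
      rw [closure_Ico hσ0.ne]; exact hc.mono (Icc_subset_Icc_right hσ.2))
    rwa [closure_Ico hσ0.ne, isClosed_Ici.closure_eq] at h2
  refine ⟨γ σ, ⟨σ, hσ, rfl⟩, x, hx, ?_, ?_⟩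
  · rw [← hxd]
    exact le_antisymm hσD (hle σ ⟨hσ.1, le_rfl⟩)
  · rintro _ ⟨r, hr, rfl⟩ hr' w hw
    rw [hγ.dist_eq le_rfl hr.1 hr.2, hγ.dist_eq le_rfl hσ.1 hσ.2] at hr'
    exact (hle r ⟨hr.1, by linarith⟩).trans (Metric.infDist_le_dist_of_mem hw)

theorem IsGeodesicSegment.dist_le_of_subset {a b x y : X} {s s' : Set X}
    (hs : IsGeodesicSegment a b s) (hs' : IsGeodesicSegment x y s') (hsub : s' ⊆ s)
    (hxy : dist a x ≤ dist a y) {z : X} (hz : z ∈ s') : dist a z ≤ dist a y := by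
  have hz' := hs'.dist_add_dist hz
  obtain ⟨L, hL, γ, hγ, rfl, rfl, rfl⟩ := hs.exists_param
  obtain ⟨t, ht, rfl⟩ := hsub hs'.left_mem
  obtain ⟨t', ht', rfl⟩ := hsub hs'.right_mem
  obtain ⟨r, hr, rfl⟩ := hsub hz
  rw [hγ.dist_eq le_rfl ht.1 ht.2, hγ.dist_eq le_rfl ht'.1 ht'.2] at hxy
  rw [hγ t ht r hr, hγ r hr t' ht', hγ t ht t' ht'] at hz'
  rw [hγ.dist_eq le_rfl hr.1 hr.2, hγ.dist_eq le_rfl ht'.1 ht'.2]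
  rcases abs_cases (t - r) with h1 | h1 <;> rcases abs_cases (r - t') with h2 | h2 <;>
    rcases abs_cases (t - t') with h3 | h3 <;> linarith

/-- A bridge realising the distance from `x` to `m` at `y` stays away from the points of `m` far
from `y`. -/
theorem IsGeodesicSegment.le_dist_bridge {x y z w : X} {e : Set X} {θ : ℝ}
    (he : IsGeodesicSegment x y e) (hz : z ∈ e) (hw : dist x y ≤ dist x w)
    (h : θ ≤ dist z y ∨ 2 * θ ≤ dist w y) : θ ≤ dist z w := by
  have h1 := he.dist_add_dist hz
  have h2 := dist_triangle x z w
  have h3 := dist_triangle_left w y z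
  rcases h with h | h <;> linarith

/-- A hexagon made of three sides `m i` and three bridges `e i` between consecutive sides, each
bridge realising the distance between the two sides. -/
theorem isFatPolygon_hexagon {θ ν : ℝ} (hθ : 0 < θ) (hν : 1 ≤ ν) {x y : Fin 3 → X}
    {m e : Fin 3 → Set X} (hm : ∀ i, IsGeodesicSegment (x i) (y i) (m i))
    (he : ∀ i, IsGeodesicSegment (y i) (x (i + 1)) (e i))
    (hD : ∀ i, ν * θ ≤ dist (y i) (x (i + 1)))
    (hmm : ∀ i, ∀ z ∈ m i, ∀ w ∈ m (i + 1), dist (y i) (x (i + 1)) ≤ dist z w)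
    (hme : ∀ i, ∀ z ∈ m i, ∀ w ∈ e (i + 1), ν * θ ≤ dist z w)
    (hee : ∀ i, ∀ z ∈ e i, ∀ w ∈ e (i + 1), ν * θ ≤ dist z w) :
    IsFatPolygon θ ν ![x 0, y 0, x 1, y 1, x 2, y 2] ![m 0, e 0, m 1, e 1, m 2, e 2] := by
  have hθν : θ ≤ ν * θ := by nlinarith
  have mm : ∀ i, ∀ z ∈ m i, ∀ w ∈ m (i + 1), ν * θ ≤ dist z w := fun i z hz w hw =>
    (hD i).trans (hmm i z hz w hw)
  have mm' : ∀ i, ∀ z ∈ m (i + 1), ∀ w ∈ m i, ν * θ ≤ dist z w := fun i z hz w hw => by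
    rw [dist_comm]; exact mm i w hw z hz
  have em : ∀ i, ∀ z ∈ e (i + 1), ∀ w ∈ m i, ν * θ ≤ dist z w := fun i z hz w hw => by
    rw [dist_comm]; exact hme i w hw z hz
  have ee' : ∀ i, ∀ z ∈ e (i + 1), ∀ w ∈ e i, ν * θ ≤ dist z w := fun i z hz w hw => by
    rw [dist_comm]; exact hee i w hw z hz
  have b1 : ∀ i, ∀ z ∈ e i, ∀ w ∈ m i, θ ≤ dist z (y i) ∨ 2 * θ ≤ dist w (y i) →
      θ ≤ dist z w := fun i z hz w hw h =>
    (he i).symm.le_dist_bridge hz (by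
      rw [dist_comm, dist_comm _ w]; exact hmm i w hw _ (hm (i + 1)).left_mem) h
  have b2 : ∀ i, ∀ z ∈ e i, ∀ w ∈ m (i + 1), θ ≤ dist z (x (i + 1)) ∨
      2 * θ ≤ dist w (x (i + 1)) → θ ≤ dist z w := fun i z hz w hw h =>
    (he i).le_dist_bridge hz (hmm i _ (hm i).right_mem w hw) h
  have em1 : ∀ i, ∀ z ∈ e i, 2 * θ ≤ dist z (y i) → ∀ w ∈ m i, θ ≤ dist z w :=
    fun i z hz h w hw => b1 i z hz w hw (Or.inl (by linarith))
  have em2 : ∀ i, ∀ z ∈ e i, 2 * θ ≤ dist z (x (i + 1)) → ∀ w ∈ m (i + 1), θ ≤ dist z w :=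
    fun i z hz h w hw => b2 i z hz w hw (Or.inl (by linarith))
  have me1 : ∀ i, ∀ w ∈ m i, 2 * θ ≤ dist w (y i) → ∀ z ∈ e i, θ ≤ dist w z :=
    fun i w hw h z hz => by rw [dist_comm]; exact b1 i z hz w hw (Or.inr h)
  have me2 : ∀ i, ∀ w ∈ m (i + 1), 2 * θ ≤ dist w (x (i + 1)) → ∀ z ∈ e i, θ ≤ dist w z :=
    fun i w hw h z hz => by rw [dist_comm]; exact b2 i z hz w hw (Or.inr h)
  constructor
  · intro i j hij p hp h1 h2 r hr
    fin_cases i <;> fin_cases j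
    · exact absurd rfl hij
    · exact me1 0 p hp h2 r hr
    · exact hθν.trans (mm 0 p hp r hr)
    · exact hθν.trans (hme 0 p hp r hr)
    · exact hθν.trans (mm' 2 p hp r hr)
    · exact me2 2 p hp h1 r hr
    · exact em1 0 p hp h1 r hr
    · exact absurd rfl hij
    · exact em2 0 p hp h2 r hr
    · exact hθν.trans (hee 0 p hp r hr)
    · exact hθν.trans (em 2 p hp r hr)
    · exact hθν.trans (ee' 2 p hp r hr)
    · exact hθν.trans (mm' 0 p hp r hr)
    · exact me2 0 p hp h1 r hr
    · exact absurd rfl hij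
    · exact me1 1 p hp h2 r hr
    · exact hθν.trans (mm 1 p hp r hr)
    · exact hθν.trans (hme 1 p hp r hr)
    · exact hθν.trans (em 0 p hp r hr)
    · exact hθν.trans (ee' 0 p hp r hr)
    · exact em1 1 p hp h1 r hr
    · exact absurd rfl hij
    · exact em2 1 p hp h2 r hr
    · exact hθν.trans (hee 1 p hp r hr)
    · exact hθν.trans (mm 2 p hp r hr)
    · exact hθν.trans (hme 2 p hp r hr)
    · exact hθν.trans (mm' 1 p hp r hr)
    · exact me2 1 p hp h1 r hr
    · exact absurd rfl hij
    · exact me1 2 p hp h2 r hr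
    · exact em2 2 p hp h2 r hr
    · exact hθν.trans (hee 2 p hp r hr)
    · exact hθν.trans (em 1 p hp r hr)
    · exact hθν.trans (ee' 1 p hp r hr)
    · exact em1 2 p hp h1 r hr
    · exact absurd rfl hij
  · have xm : ∀ i, ∀ r ∈ m i, ν * θ ≤ dist (x (i + 1)) r := fun i =>
      mm' i _ (hm (i + 1)).left_mem
    have ym : ∀ i, ∀ r ∈ m (i + 1), ν * θ ≤ dist (y i) r := fun i => mm i _ (hm i).right_mem
    have xm' : ∀ i, ∀ r ∈ m i, ν * θ ≤ dist (x (i + 1 + 1)) r := fun i =>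
      em i _ (he (i + 1)).right_mem
    have ym' : ∀ i, ∀ r ∈ m i, ν * θ ≤ dist (y (i + 1)) r := fun i =>
      em i _ (he (i + 1)).left_mem
    have ye : ∀ i, ∀ r ∈ e (i + 1), ν * θ ≤ dist (y i) r := fun i => hee i _ (he i).left_mem
    have ye' : ∀ i, ∀ r ∈ e i, ν * θ ≤ dist (y (i + 1)) r := fun i =>
      ee' i _ (he (i + 1)).left_mem
    have xe : ∀ i, ∀ r ∈ e (i + 1), ν * θ ≤ dist (x (i + 1)) r := fun i =>
      hee i _ (he i).right_mem
    have xe' : ∀ i, ∀ r ∈ e i, ν * θ ≤ dist (x (i + 1 + 1)) r := fun i =>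
      ee' i _ (he (i + 1)).right_mem
    intro i j hij hij' r hr
    fin_cases i <;> fin_cases j <;> first
      | exact absurd rfl hij
      | exact absurd rfl hij'
      | exact xm 0 r hr
      | exact xm 1 r hr
      | exact xm 2 r hr
      | exact ym 0 r hr
      | exact ym 1 r hr
      | exact ym 2 r hr
      | exact xm' 0 r hr
      | exact xm' 1 r hr
      | exact xm' 2 r hr
      | exact ym' 0 r hr
      | exact ym' 1 r hr
      | exact ym' 2 r hr
      | exact xe 0 r hr
      | exact xe 1 r hr
      | exact xe 2 r hr
      | exact ye 0 r hr
      | exact ye 1 r hr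
      | exact ye 2 r hr
      | exact xe' 0 r hr
      | exact xe' 1 r hr
      | exact xe' 2 r hr
      | exact ye' 0 r hr
      | exact ye' 1 r hr
      | exact ye' 2 r hr

theorem isGeodesicPolygon_hexagon {x y : Fin 3 → X} {m e : Fin 3 → Set X}
    (hm : ∀ i, IsGeodesicSegment (x i) (y i) (m i))
    (he : ∀ i, IsGeodesicSegment (y i) (x (i + 1)) (e i)) :
    IsGeodesicPolygon ![x 0, y 0, x 1, y 1, x 2, y 2] ![m 0, e 0, m 1, e 1, m 2, e 2] := by
  intro i
  fin_cases i
  exacts [hm 0, he 0, hm 1, he 1, hm 2, he 2]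

end FatHexagon

namespace ConeData

variable {X : Type*} [MetricSpace X] {C : ConeData X}

theorem exists_separation {x : C.BddSeq} {A : ℕ → Set X} (h : C.limPt x ∉ C.limSet A) :
    ∃ ε > 0, ∀ᶠ n in (C.ω : Filter ℕ), ∀ a ∈ A n, ε * C.d n < dist (x.seq n) a := by
  by_contra! hcon
  exact h (mem_limSet_of_eventually hcon)

/-- Short geodesics near a point outside a limit set are far away from the approximating sets. -/
theorem eventually_le_dist {x y : C.BddSeq} {e A : ℕ → Set X}
    (he : ∀ n, IsGeodesicSegment (x.seq n) (y.seq n) (e n)) (hxy : C.limPt x = C.limPt y)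
    (h : C.limPt x ∉ C.limSet A) (K : ℝ) :
    ∀ᶠ n in (C.ω : Filter ℕ), ∀ z ∈ A n, ∀ w ∈ e n, K ≤ dist z w := by
  obtain ⟨ε, hε, h1⟩ := exists_separation h
  have h2 : dist (C.limPt x) (C.limPt y) < ε / 2 := by rw [hxy, dist_self]; exact half_pos hε
  filter_upwards [h1, eventually_dist_le h2, eventually_le_mul K (half_pos hε)]
    with n h3 h4 h5 z hz w hw
  have h6 := h3 z hz
  have h7 := (he n).dist_add_dist hw
  have h8 := dist_triangle_right (x.seq n) z w
  linarith [dist_nonneg (x := w) (y := y.seq n)]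

theorem limPt_mem_limSet {x : C.BddSeq} {A : ℕ → Set X}
    (h : ∀ᶠ n in (C.ω : Filter ℕ), x.seq n ∈ A n) : C.limPt x ∈ C.limSet A :=
  ⟨x, h, rfl⟩

/-- Cutting the corner between two sequences of geodesics whose limits only meet in a point. -/
theorem exists_corner {a b a' b' : C.BddSeq} {g g' : ℕ → Set X}
    (hg : ∀ n, IsGeodesicSegment (a.seq n) (b.seq n) (g n))
    (hg' : ∀ n, IsGeodesicSegment (a'.seq n) (b'.seq n) (g' n)) (hba : C.limPt b = C.limPt a')
    (ha : C.limPt a ∉ C.limSet g') (hmeet : C.limSet g ∩ C.limSet g' ⊆ {C.limPt b}) (K : ℝ) :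
    ∃ y x : C.BddSeq, C.limPt y = C.limPt b ∧ C.limPt x = C.limPt b ∧
      ∀ᶠ n in (C.ω : Filter ℕ), y.seq n ∈ g n ∧ x.seq n ∈ g' n ∧ K ≤ dist (y.seq n) (x.seq n) ∧
        ∀ z ∈ g n, dist (a.seq n) z ≤ dist (a.seq n) (y.seq n) → ∀ w ∈ g' n,
          dist (y.seq n) (x.seq n) ≤ dist z w := by
  obtain ⟨D, hD⟩ : ∃ D : ℕ → ℝ, ∀ n, D n = max K (dist (b.seq n) (a'.seq n)) := ⟨_, fun _ => rfl⟩
  have hDε : ∀ ε > 0, ∀ᶠ n in (C.ω : Filter ℕ), D n ≤ ε * C.d n := by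
    intro ε hε
    filter_upwards [eventually_le_mul K hε,
      eventually_dist_le (x := b) (y := a') (r := ε) (by rwa [hba, dist_self])] with n h1 h2
    rw [hD]
    exact max_le h1 h2
  obtain ⟨ε, hε, hsep⟩ := exists_separation ha
  have h1 : ∀ᶠ n in (C.ω : Filter ℕ), ∃ p : X × X, p.1 ∈ g n ∧ p.2 ∈ g' n ∧ dist p.1 p.2 = D n ∧
      ∀ z ∈ g n, dist (a.seq n) z ≤ dist (a.seq n) p.1 → ∀ w ∈ g' n, D n ≤ dist z w := by
    filter_upwards [hsep, hDε ε hε] with n h1 h2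
    obtain ⟨y, hy, x, hx, h3, h4⟩ := (hg n).exists_first (hg' n).isCompact
      (fun w hw => h2.trans_lt (h1 w hw))
      ⟨_, (hg' n).left_mem, (le_max_right K _).trans (hD n).symm.le⟩
    exact ⟨(y, x), hy, hx, h3, h4⟩
  obtain ⟨p, hp⟩ := h1.choice
  obtain ⟨y, hy⟩ : ∃ y : C.BddSeq, y.seq = fun n => (p n).1 := by
    refine exists_bddSeq a (M := dist (C.limPt a) (C.limPt b) + 1) ?_
    filter_upwards [hp, eventually_dist_le (lt_add_one (dist (C.limPt a) (C.limPt b)))] with n h2 h3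
    have h4 := (hg n).dist_add_dist h2.1
    linarith [dist_nonneg (x := (p n).1) (y := b.seq n)]
  have hyx : ∀ ε > 0, ∀ᶠ n in (C.ω : Filter ℕ), dist (y.seq n) (p n).2 ≤ ε * C.d n := by
    intro ε hε
    filter_upwards [hp, hDε ε hε] with n h2 h3
    simp only [hy]
    rw [h2.2.2.1]
    exact h3
  obtain ⟨x, hx⟩ : ∃ x : C.BddSeq, x.seq = fun n => (p n).2 := exists_bddSeq y (hyx 1 one_pos)
  have hlim : C.limPt y = C.limPt x := limPt_eq_of_eventually (by simpa only [hx] using hyx)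
  have hyb : C.limPt y = C.limPt b := by
    refine hmeet ⟨limPt_mem_limSet (hp.mono fun n hn => by rw [hy]; exact hn.1), ?_⟩
    rw [hlim]
    exact limPt_mem_limSet (hp.mono fun n hn => by rw [hx]; exact hn.2.1)
  refine ⟨y, x, hyb, hlim.symm.trans hyb, ?_⟩
  filter_upwards [hp] with n hn
  simp only [hy, hx]
  rw [hn.2.2.1]
  exact ⟨hn.1, hn.2.1, (le_max_left K _).trans (hD n).symm.le, hn.2.2.2⟩

theorem isClosed_of_mem_limitCollection {ι : Type*} {A : ι → Set X} {B : Set C.Cone}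
    (hB : B ∈ C.limitCollection A) : IsClosed B := by
  obtain ⟨i, -, rfl⟩ := hB
  exact isClosed_limSet _

/-- Property `(β₃)` implies property `(Π₃)` for the collections of limit sets. -/
theorem propPi3_of_propBeta3 (hX : IsGeodesicSpace X) {ι : Type*} {A : ι → Set X}
    (hA : PropBeta3 A) : C.PropPi3 (C.limitCollection A) := by
  intro v q hq hlim
  obtain ⟨θ, ν, χ, hθ, hν, hχ, hfat⟩ := hA
  have h3 : ∀ i : Fin 3, i + 1 + 1 + 1 = i := by decide
  choose a b g hg ha hb hgq using fun i => (hlim i).exists_seq Subset.rfl (hq.1 i)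
  choose y x' hy hx' hcut using fun i => exists_corner (hg i) (hg (i + 1))
    ((hb i).trans (ha (i + 1)).symm) (by rw [ha, hgq]; exact hq.vertex_notMem i)
    (by rw [hgq, hgq, hb, hq.2.1]) (ν * θ)
  obtain ⟨x, hx⟩ : ∃ x : Fin 3 → C.BddSeq, ∀ i, x (i + 1) = x' i :=
    ⟨fun i => x' (i + 1 + 1), fun i => by
      simp only [show i + 1 + 1 + 1 = i from h3 i]⟩
  simp only [← hx] at hcut hx'
  have hyv : ∀ i, C.limPt (y i) = v (i + 1) := fun i => (hy i).trans (hb i)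
  have hxv' : ∀ i, C.limPt (x (i + 1)) = v (i + 1) := fun i => (hx' i).trans (hb i)
  have hxv : ∀ i, C.limPt (x i) = v i := fun i => by
    have := hxv' (i + 1 + 1)
    rwa [h3] at this
  have hxg : ∀ i, ∀ᶠ n in (C.ω : Filter ℕ), (x i).seq n ∈ g i n := fun i => by
    have := hcut (i + 1 + 1)
    rw [h3] at this
    exact this.mono fun n hn => hn.2.1
  have hexm : ∀ i n, ∃ s, IsGeodesicSegment ((x i).seq n) ((y i).seq n) s ∧
      ((x i).seq n ∈ g i n → (y i).seq n ∈ g i n → s ⊆ g i n) := by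
    intro i n
    by_cases h : (x i).seq n ∈ g i n ∧ (y i).seq n ∈ g i n
    · obtain ⟨s, hs, hs'⟩ := (hg i n).exists_subsegment h.1 h.2
      exact ⟨s, hs', fun _ _ => hs⟩
    · obtain ⟨s, hs⟩ := hX ((x i).seq n) ((y i).seq n)
      exact ⟨s, hs, fun h1 h2 => absurd ⟨h1, h2⟩ h⟩
  choose m hm hmg using hexm
  choose e he using fun i n => hX ((y i).seq n) ((x (i + 1)).seq n)
  have hmg' : ∀ i, ∀ᶠ n in (C.ω : Filter ℕ), m i n ⊆ g i n := fun i => by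
    filter_upwards [hxg i, hcut i] with n h1 h2 using hmg i n h1 h2.1
  have hmq : ∀ i, C.limSet (m i) = q i := fun i => by
    have h1 := isGeodesicSegment_limSet (x i) (y i) (hm i)
    rw [hxv, hyv] at h1
    have h2 : C.limSet (m i) ⊆ q i := hgq i ▸ limSet_mono (hmg' i)
    exact h2.antisymm ((hq.1 i).subset_of_subset (hq.1 i) h1 Subset.rfl h2)
  have heq : ∀ i, C.limSet (e i) ⊆ {v (i + 1)} := fun i => by
    have h1 := isGeodesicSegment_limSet (y i) (x (i + 1)) (he i)
    rw [hyv, hxv] at h1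
    intro z hz
    have h2 := h1.dist_add_dist hz
    rw [dist_self] at h2
    exact dist_le_zero.1 (by rw [dist_comm]; linarith [dist_nonneg (x := z) (y := v (i + 1))])
  have hyx : ∀ i, C.limPt (y i) = C.limPt (x (i + 1)) := fun i => (hyv i).trans (hxv _).symm
  have hme : ∀ i, ∀ᶠ n in (C.ω : Filter ℕ), ∀ z ∈ m i n, ∀ w ∈ e (i + 1) n,
      ν * θ ≤ dist z w := fun i => by
    refine eventually_le_dist (he (i + 1)) (hyx _) ?_ _
    rw [hyv, hmq]
    have := hq.vertex_notMem (i + 1 + 1)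
    rwa [h3] at this
  have hee : ∀ i, ∀ᶠ n in (C.ω : Filter ℕ), ∀ z ∈ e i n, ∀ w ∈ e (i + 1) n,
      ν * θ ≤ dist z w := fun i => by
    refine eventually_le_dist (he (i + 1)) (hyx _) (fun h => ?_) _
    rw [hyv] at h
    exact hq.vertex_ne (i + 1) (heq i h).symm
  have hmm : ∀ i, ∀ᶠ n in (C.ω : Filter ℕ), ν * θ ≤ dist ((y i).seq n) ((x (i + 1)).seq n) ∧
      ∀ z ∈ m i n, ∀ w ∈ m (i + 1) n,
        dist ((y i).seq n) ((x (i + 1)).seq n) ≤ dist z w := fun i => by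
    have h1 : ∀ᶠ n in (C.ω : Filter ℕ), dist ((a i).seq n) ((x i).seq n) / C.d n <
        dist ((a i).seq n) ((y i).seq n) / C.d n := by
      refine (tendsto_dist_div (a i) (x i)).eventually_lt (tendsto_dist_div (a i) (y i)) ?_
      rw [ha, hxv, hyv, dist_self]
      exact dist_pos.2 (hq.vertex_ne i)
    filter_upwards [h1, hcut i, hmg' i, hmg' (i + 1)] with n h2 h4 h5 h6
    rw [div_lt_div_iff_of_pos_right (C.d_pos n)] at h2
    exact ⟨h4.2.2.1, fun z hz w hw => h4.2.2.2 z (h5 hz)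
      ((hg i n).dist_le_of_subset (hm i n) h5 h2.le hz) w (h6 hw)⟩
  have hsub : ∀ᶠ n in (C.ω : Filter ℕ), ∃ j : ι, ∀ i, m i n ⊆ Metric.thickening χ (A j) := by
    filter_upwards [eventually_all.2 hme, eventually_all.2 hee, eventually_all.2 hmm]
      with n h1 h2 h4
    obtain ⟨j, hj⟩ := hfat _ _
      (isGeodesicPolygon_hexagon (fun i => hm i n) (fun i => he i n))
      (isFatPolygon_hexagon hθ (by linarith) (fun i => hm i n) (fun i => he i n)
        (fun i => (h4 i).1) (fun i => (h4 i).2) h1 h2)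
    refine ⟨j, fun i => Subset.trans ?_ hj⟩
    fin_cases i
    · exact subset_iUnion ![m 0 n, e 0 n, m 1 n, e 1 n, m 2 n, e 2 n] 0
    · exact subset_iUnion ![m 0 n, e 0 n, m 1 n, e 1 n, m 2 n, e 2 n] 2
    · exact subset_iUnion ![m 0 n, e 0 n, m 1 n, e 1 n, m 2 n, e 2 n] 4
  obtain ⟨j, hj⟩ := hsub.choice
  refine ⟨C.limSet fun n => A (j n), ⟨j, ?_, rfl⟩, iUnion_subset fun i => ?_⟩
  · obtain ⟨M, hM⟩ := (x 0).bdd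
    refine ⟨M + 1, ?_⟩
    filter_upwards [hM, hj, eventually_le_mul χ one_pos] with n h1 h2 h4
    obtain ⟨z, hz, hd⟩ := Metric.mem_thickening_iff.1 (h2 0 (hm 0 n).left_mem)
    refine (Metric.infEDist_le_edist_of_mem hz).trans ?_
    rw [edist_dist]
    refine ENNReal.ofReal_le_ofReal ?_
    linarith [dist_triangle_left (C.e n) z ((x 0).seq n)]
  · rw [← hmq]
    exact limSet_subset_of_thickening (hj.mono fun n hn => hn i)

end ConeData

theorem mainTheorem7 {X : Type*} [MetricSpace X] (hX : IsGeodesicSpace X) :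
    (∀ (C : ConeData X) (P : Set (Set C.Cone)), (∀ B ∈ P, IsClosed B) →
      PropT1 P → C.PropPi3 P → PropT2 P) ∧
    (∀ (ι : Type*) (A : ι → Set X), PropBeta3 A →
      (∀ C : ConeData X, PropT1 (C.limitCollection A)) →
        ∀ C : ConeData X, PropT2 (C.limitCollection A)) := by
  refine ⟨fun C P hP hT hPi => ConeData.propT2_of_propPi3 hX hP hT hPi, fun ι A hA hT C => ?_⟩
  exact ConeData.propT2_of_propPi3 hX (fun B hB => ConeData.isClosed_of_mem_limitCollection hB)
    (hT C) (ConeData.propPi3_of_propBeta3 hX hA)
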